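/- Let $q\ge 1$ and let $X$ be a $(q+1)$-regular tree, with automorphism group $G$. Give $G$ the topology in which the pointwise stabilizers of nonempty finite sets of vertices form a basis of neighbourhoods of $1$, and fix a Haar measure $dx$ on $G$. Fix a line $l=(\dots,v_{-1},v_0,v_1,\dots)$ in $X$ (a two-sided infinite path without backtracking), and let $\infty$ be the boundary point defined by the ray $(v_0,v_1,\dots)$. Let $P\subset G$ be the stabilizer of $\infty$, let $S\subset P$ be the subgroup of elements preserving every horosphere at $\infty$, let $L\subset P$ be the subgroup of elements preserving the line $l$, and put $M=L\cap S$. Let $A\subset L$ be the image of a splitting of $1\to M\to L\to L/M\to 1$, and let $A^-$ be the set of $a\in A$ for which there is an integer $n>0$ with $a v_j=v_{j-n}$ for all $j$. An element of $G$ is called hyperbolic if it fixes no vertex and no midpoint of an edge; let $G_{hyp}$ be the set of hyperbolic elements. Let $\pi$ be an admissible representation of $G$ on a complex vector space, i.e. every vector is fixed by a compact open subgroup and, for every compact open subgroup $K$, the space $\pi^K$ of $K$-fixed vectors is finite-dimensional. Let $\pi_S$ be the space of $S$-coinvariants, i.e. the quotient of $\pi$ by the span of all $v-\pi(s)v$ with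 $v\in\pi$, $s\in S$, with its action of $P$. Then $\pi_S$ is finite-dimensional, and there is exactly one function $\theta_\pi$ on $G_{hyp}$ that is invariant under conjugation by $G$ and satisfies $\theta_\pi(a)=\operatorname{tr}(a\mid\pi_S)$ for all $a\in A^-$. Let $f\colon G\to\mathbb C$ be a Hecke function (integrable, and bi-invariant under some compact open subgroup of $G$) that vanishes outside $G_{hyp}$. Suppose that the integral $\pi(f)=\int_G f(x)\pi(x)\,dx$ converges, in the sense that $x\mapsto f(x)\,\eta(\pi(x)v)$ is integrable for every $v\in\pi$ and every smooth linear functional $\eta$ on $\pi$ (one fixed by a compact open subgroup); this holds for every such $f$ with compact support. Then there is exactly one linear operator $\pi(f)$ on $\pi$ with $\eta(\pi(f)v)=\int_G f(x)\,\eta(\pi(x)v)\,dx$ for all such $v$ and $\eta$; it has finite rank, $f\theta_\pi$ is integrable on $G_{hyp}$, and $$\operatorname{tr}\pi(f)=\int_{G_{hyp}} f(x)\,\theta_\pi(x)\,dx=\int_G f(x)\,\theta_\pi(x)\,dx ,$$ where $\theta_\pi$ is extended by $0$ to $G$. -/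

import Mathlib

open MeasureTheory

noncomputable section

namespace TreeCharacter

/-! ## The automorphism group of a graph and its topology -/

/-- The group `G` of automorphisms of the graph `X`; the product is composition. -/
abbrev Aut {V : Type*} (X : SimpleGraph V) : Type _ := X ≃g X

/-- The topology of pointwise convergence on vertices (vertices carrying the discrete topology).
A basis of neighbourhoods of `1` is given by the pointwise stabilizers of finite sets of
vertices. -/
instance autTopology {V : Type*} (X : SimpleGraph V) : TopologicalSpace (Aut X) :=
  TopologicalSpace.induced (fun (g : Aut X) (v : V) => g v)
    (@Pi.topologicalSpace V (fun _ => V) (fun _ => ⊥))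

/-- The Borel sigma-algebra on `G`. -/
instance autMeasurableSpace {V : Type*} (X : SimpleGraph V) : MeasurableSpace (Aut X) :=
  borel (Aut X)

instance autBorelSpace {V : Type*} (X : SimpleGraph V) : BorelSpace (Aut X) := ⟨rfl⟩

/-! ## Rays, lines and the boundary -/

/-- A ray: a one-sided infinite path without backtracking. -/
@[ext]
structure Ray {V : Type*} (X : SimpleGraph V) where
  /-- the sequence of vertices -/
  vert : ℕ → V
  adj : ∀ j, X.Adj (vert j) (vert (j + 1))
  noBacktrack : ∀ j, vert j ≠ vert (j + 2)

/-- A line: a two-sided infinite path without backtracking. -/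
structure Line {V : Type*} (X : SimpleGraph V) where
  /-- the sequence of vertices -/
  vert : ℤ → V
  adj : ∀ j, X.Adj (vert j) (vert (j + 1))
  noBacktrack : ∀ j, vert j ≠ vert (j + 2)

/-- Two rays are parallel if they agree eventually, up to a shift. -/
def Parallel {V : Type*} {X : SimpleGraph V} (r s : Ray X) : Prop :=
  ∃ m n : ℕ, ∀ j : ℕ, r.vert (m + j) = s.vert (n + j)

/-- Parallelity is an equivalence relation. -/
instance raySetoid {V : Type*} (X : SimpleGraph V) : Setoid (Ray X) where
  r := Parallel
  iseqv :=
    { refl := fun _ => ⟨0, 0, fun _ => rfl⟩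
      symm := fun ⟨m, n, h⟩ => ⟨n, m, fun j => (h j).symm⟩
      trans := by
        rintro r s t ⟨m, n, h⟩ ⟨m', n', h'⟩
        refine ⟨m + m', n' + n, fun j => ?_⟩
        rw [add_assoc, h, add_assoc, ← h']
        congr 1
        omega }

/-- The boundary of `X`: parallelity classes of rays (cusps). -/
def Boundary {V : Type*} (X : SimpleGraph V) : Type _ := Quotient (raySetoid X)

/-- The cusp defined by a ray. -/
def cusp {V : Type*} {X : SimpleGraph V} (r : Ray X) : Boundary X := Quotient.mk _ r

/-- The image of a ray under an automorphism. -/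
def Ray.map {V : Type*} {X : SimpleGraph V} (g : Aut X) (r : Ray X) : Ray X where
  vert j := g (r.vert j)
  adj j := g.map_adj_iff.2 (r.adj j)
  noBacktrack j h := r.noBacktrack j (g.injective h)

/-- The action of `G` on the boundary. -/
instance boundaryAction {V : Type*} (X : SimpleGraph V) : MulAction (Aut X) (Boundary X) where
  smul g := Quotient.map (Ray.map g) fun _ _ ⟨m, n, h⟩ => ⟨m, n, fun j => congrArg g (h j)⟩
  one_smul b := by
    induction b using Quotient.inductionOn with
    | h r => rfl
  mul_smul g h b := by
    induction b using Quotient.inductionOn with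
    | h r => rfl

theorem smul_cusp {V : Type*} {X : SimpleGraph V} (g : Aut X) (r : Ray X) :
    g • cusp r = cusp (r.map g) := rfl

/-- Two vertices lie in the same horosphere with respect to `b` if the rays in the class `b` that
start at these vertices have the same `N`-th vertex for some `N`. -/
def SameHorosphere {V : Type*} {X : SimpleGraph V} (b : Boundary X) (x y : V) : Prop :=
  ∃ r s : Ray X, r.vert 0 = x ∧ s.vert 0 = y ∧ cusp r = b ∧ cusp s = b ∧
    ∃ N : ℕ, r.vert N = s.vert N

/-! ## The subgroups `P`, `S`, `L`, `M` -/

/-- The parabolic subgroup `P`: the stabilizer of the cusp `b`. -/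
def parabolic {V : Type*} {X : SimpleGraph V} (b : Boundary X) : Subgroup (Aut X) :=
  MulAction.stabilizer (Aut X) b

/-- The subgroup `S` of `P` of those elements that map every horosphere to itself. -/
def horoStab {V : Type*} {X : SimpleGraph V} (b : Boundary X) : Subgroup (Aut X) where
  carrier := {g | g ∈ parabolic b ∧
    ∀ x y, SameHorosphere b x (g y) ↔ SameHorosphere b x y}
  one_mem' := ⟨one_mem _, fun _ _ => Iff.rfl⟩
  mul_mem' := fun {g h} hg hh =>
    ⟨mul_mem hg.1 hh.1, fun x y => (hg.2 x (h y)).trans (hh.2 x y)⟩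
  inv_mem' := fun {g} hg => ⟨inv_mem hg.1, fun x y => by
    have := hg.2 x (g⁻¹ y)
    rw [← this, RelIso.apply_inv_self]⟩

/-- The cusp `∞` at the positive end of a line. -/
def Line.infty {V : Type*} {X : SimpleGraph V} (l : Line X) : Boundary X :=
  cusp
    { vert := fun j => l.vert j
      adj := fun j => by simpa using l.adj j
      noBacktrack := fun j => by simpa using l.noBacktrack j }

/-- The Levi component `L` of `P`: the elements of `P` that preserve the line `l`. -/
def levi {V : Type*} {X : SimpleGraph V} (l : Line X) : Subgroup (Aut X) where
  carrier := {g | g ∈ parabolic l.infty ∧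
    ∀ x, g x ∈ Set.range l.vert ↔ x ∈ Set.range l.vert}
  one_mem' := ⟨one_mem _, fun _ => Iff.rfl⟩
  mul_mem' := fun {g h} hg hh =>
    ⟨mul_mem hg.1 hh.1, fun x => (hg.2 (h x)).trans (hh.2 x)⟩
  inv_mem' := fun {g} hg => ⟨inv_mem hg.1, fun x => by
    have := hg.2 (g⁻¹ x)
    rw [← this, RelIso.apply_inv_self]⟩

/-- The group `M`, the intersection of `L` and `S`. -/
def compactLevi {V : Type*} {X : SimpleGraph V} (l : Line X) : Subgroup (Aut X) :=
  levi l ⊓ horoStab l.infty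

theorem sameHorosphere_map {V : Type*} {X : SimpleGraph V} {b : Boundary X} {g : Aut X}
    (hg : g ∈ parabolic b) {x y : V} (h : SameHorosphere b x y) :
    SameHorosphere b (g x) (g y) := by
  obtain ⟨r, s, rfl, rfl, hr, hs, N, hN⟩ := h
  have hb : g • b = b := hg
  refine ⟨r.map g, s.map g, rfl, rfl, ?_, ?_, N, congrArg g hN⟩
  · rw [← smul_cusp, hr, hb]
  · rw [← smul_cusp, hs, hb]

theorem sameHorosphere_map_iff {V : Type*} {X : SimpleGraph V} {b : Boundary X} {g : Aut X}
    (hg : g ∈ parabolic b) {x y : V} :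
    SameHorosphere b (g x) y ↔ SameHorosphere b x (g⁻¹ y) := by
  constructor
  · intro h
    have := sameHorosphere_map (inv_mem hg) h
    rwa [RelIso.inv_apply_self] at this
  · intro h
    have := sameHorosphere_map hg h
    rwa [RelIso.apply_inv_self] at this

theorem horoStab_conj {V : Type*} {X : SimpleGraph V} {b : Boundary X} {g s : Aut X}
    (hg : g ∈ parabolic b) (hs : s ∈ horoStab b) : g * s * g⁻¹ ∈ horoStab b := by
  refine ⟨mul_mem (mul_mem hg hs.1) (inv_mem hg), fun x y => ?_⟩
  have h1 := sameHorosphere_map_iff (inv_mem hg) (x := x) (y := s (g⁻¹ y))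
  have h2 := sameHorosphere_map_iff (inv_mem hg) (x := x) (y := g⁻¹ y)
  rw [inv_inv] at h1 h2
  rw [RelIso.apply_inv_self] at h2
  exact h1.symm.trans ((hs.2 _ _).trans h2)

/-- `S` is normal in `P`. -/
instance horoStab_normal {V : Type*} {X : SimpleGraph V} (b : Boundary X) :
    ((horoStab b).subgroupOf (parabolic b)).Normal where
  conj_mem _ hs g := horoStab_conj g.2 hs

/-- `M` is normal in `L`. -/
instance compactLevi_normal {V : Type*} {X : SimpleGraph V} (l : Line X) :
    ((compactLevi l).subgroupOf (levi l)).Normal where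
  conj_mem m hm g :=
    ⟨(levi l).mul_mem ((levi l).mul_mem g.2 m.2) ((levi l).inv_mem g.2),
      horoStab_conj g.2.1 hm.2⟩

/-- A splitting of the exact sequence `1 → M → L → L/M → 1`. -/
def IsSplitting {V : Type*} {X : SimpleGraph V} (l : Line X)
    (σ : (levi l ⧸ (compactLevi l).subgroupOf (levi l)) →* levi l) : Prop :=
  ∀ c, (QuotientGroup.mk (σ c) : levi l ⧸ (compactLevi l).subgroupOf (levi l)) = c

/-- The group `A`, the image of a splitting, as a subgroup of `P`. -/
def splitTorus {V : Type*} {X : SimpleGraph V} (l : Line X)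
    (σ : (levi l ⧸ (compactLevi l).subgroupOf (levi l)) →* levi l) :
    Subgroup (parabolic l.infty) :=
  (σ.range.map (levi l).subtype).subgroupOf (parabolic l.infty)

/-- The set `A⁻` of those elements of `A` that translate the line by a positive amount away
from `∞`. -/
def negTorus {V : Type*} {X : SimpleGraph V} (l : Line X)
    (σ : (levi l ⧸ (compactLevi l).subgroupOf (levi l)) →* levi l) :
    Set (parabolic l.infty) :=
  {a | a ∈ splitTorus l σ ∧ ∃ n : ℤ, 0 < n ∧ ∀ j, (a : Aut X) (l.vert j) = l.vert (j - n)}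

/-! ## Hyperbolic elements -/

/-- `g` is elliptic if it fixes a point of the geometric realization of `X`; equivalently it fixes
a vertex or the midpoint of an edge. The latter means that it maps the edge to itself. -/
def IsElliptic {V : Type*} {X : SimpleGraph V} (g : Aut X) : Prop :=
  (∃ v, g v = v) ∨ ∃ e ∈ X.edgeSet, Sym2.map g e = e

/-- The set of hyperbolic elements of `G`. -/
def hyperbolicSet {V : Type*} (X : SimpleGraph V) : Set (Aut X) := {g | ¬ IsElliptic g}

/-! ## Smooth and admissible representations -/

/-- `v` is a smooth vector: it is fixed by a compact open subgroup. -/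
def IsSmoothVector {G E : Type*} [Group G] [TopologicalSpace G] [AddCommGroup E] [Module ℂ E]
    (π : Representation ℂ G E) (v : E) : Prop :=
  ∃ K : Subgroup G, IsOpen (K : Set G) ∧ IsCompact (K : Set G) ∧ ∀ k ∈ K, π k v = v

/-- A representation is admissible if it is smooth and the spaces of fixed vectors of
compact open subgroups are finite-dimensional. -/
structure IsAdmissible {G E : Type*} [Group G] [TopologicalSpace G] [AddCommGroup E] [Module ℂ E]
    (π : Representation ℂ G E) : Prop where
  smooth : ∀ v, IsSmoothVector π v
  finite : ∀ K : Subgroup G, IsOpen (K : Set G) → IsCompact (K : Set G) →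
    FiniteDimensional ℂ (Representation.invariants (π.comp K.subtype))

/-- The space `π_S` of `S`-coinvariants. -/
abbrev jacquetSpace {V E : Type*} {X : SimpleGraph V} [AddCommGroup E] [Module ℂ E]
    (π : Representation ℂ (Aut X) E) (b : Boundary X) : Type _ :=
  Representation.Coinvariants ((π.comp (parabolic b).subtype).comp
    ((horoStab b).subgroupOf (parabolic b)).subtype)

/-- The action of `P` on the space `π_S` of `S`-coinvariants. -/
def jacquet {V E : Type*} {X : SimpleGraph V} [AddCommGroup E] [Module ℂ E]
    (π : Representation ℂ (Aut X) E) (b : Boundary X) :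
    Representation ℂ (parabolic b) (jacquetSpace π b) :=
  Representation.toCoinvariants (π.comp (parabolic b).subtype)
    ((horoStab b).subgroupOf (parabolic b))

/-! ## Hecke functions and their operators -/

/-- A Hecke function: integrable and bi-invariant under a compact open subgroup. -/
structure IsHeckeFunction {G : Type*} [Group G] [TopologicalSpace G] [MeasurableSpace G]
    (μ : Measure G) (f : G → ℂ) : Prop where
  integrable : Integrable f μ
  biinvariant : ∃ K : Subgroup G, IsOpen (K : Set G) ∧ IsCompact (K : Set G) ∧
    ∀ k ∈ K, ∀ k' ∈ K, ∀ x, f (k * x * k') = f x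

/-- The integral `π(f) = ∫ f(x) π(x) dx` converges (weakly and absolutely): for every vector `v`
and every smooth linear functional `η`, the function `f(x) η(π(x)v)` is integrable. -/
def HeckeConverges {G E : Type*} [Group G] [TopologicalSpace G] [MeasurableSpace G]
    [AddCommGroup E] [Module ℂ E] (π : Representation ℂ G E) (μ : Measure G) (f : G → ℂ) : Prop :=
  ∀ (v : E) (η : Module.Dual ℂ E), IsSmoothVector π.dual η →
    Integrable (fun x => f x * η (π x v)) μ

/-- `T` is the operator `π(f) = ∫ f(x) π(x) dx`, the integral being tested against smooth linear
functionals. -/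
def IsHeckeOperator {G E : Type*} [Group G] [TopologicalSpace G] [MeasurableSpace G]
    [AddCommGroup E] [Module ℂ E] (π : Representation ℂ G E) (μ : Measure G) (f : G → ℂ)
    (T : E →ₗ[ℂ] E) : Prop :=
  ∀ (v : E) (η : Module.Dual ℂ E), IsSmoothVector π.dual η →
    η (T v) = ∫ x, f x * η (π x v) ∂μ

/-- The trace of an operator of finite rank, possibly on an infinite-dimensional space: the trace
of its restriction to its range. -/
def finiteRankTrace {E : Type*} [AddCommGroup E] [Module ℂ E] (T : E →ₗ[ℂ] E) : ℂ :=
  LinearMap.trace ℂ (LinearMap.range T)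
    (T.restrict (p := LinearMap.range T) (q := LinearMap.range T)
      fun x _ => LinearMap.mem_range_self T x)

/-- `θ` is the character function `θ_π` on the hyperbolic set, extended by zero to `G`: it is
conjugation-invariant and `θ(a) = tr (a | π_S)` for `a` in `A⁻`. -/
structure IsHyperbolicCharacter {V E : Type*} {X : SimpleGraph V} [AddCommGroup E] [Module ℂ E]
    (π : Representation ℂ (Aut X) E) (l : Line X)
    (σ : (levi l ⧸ (compactLevi l).subgroupOf (levi l)) →* levi l) (θ : Aut X → ℂ) : Prop where
  zero_off : ∀ g, g ∉ hyperbolicSet X → θ g = 0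
  conj : ∀ g ∈ hyperbolicSet X, ∀ h, θ (h * g * h⁻¹) = θ g
  trace_eq : ∀ a ∈ negTorus l σ, θ (a : Aut X) =
    LinearMap.trace ℂ (jacquetSpace π l.infty) (jacquet π l.infty a)

end TreeCharacter

end

/-! Let `K` be the fixator of a ball under which `f` is bi-invariant, and `e_K` the average over
`K`. Left invariance forces `π(f)` into the finite-dimensional space `π^K`, and a basis of it gives
`tr π(f) = ∫ f(x) tr(e_K π(x) | π^K) dx` (`exists_heckeOperator`). So it suffices that this local
trace equals `θ x` wherever `f x ≠ 0`.

At such `x`, right invariance and the support condition make all of `x K` hyperbolic. If the ball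
contained no edge of the axis of `x`, some `k ∈ K` would reverse the axis, and `x k` would act on it
as a reflection, hence be elliptic (`dist_proj_lt_of_hyperbolic`). So the ball contains an edge of
the axis. Translation length determines a hyperbolic element up to conjugacy
(`exists_conj_of_translation`), which reduces to `x = a ∈ A⁻` and a ball containing an edge of `l`.

The core is then Jacquet's argument (`trace_localOperator_ball`). The edge cuts the tree into two
half-trees, and `K` is the product of commuting groups `Kl`, acting away from `∞`, and `Kr`, acting
on the side of `∞`, with `a Kl a⁻¹ ≤ Kl` and `a⁻¹ Kr a ≤ Kr`. Hence on `π^K` the operator `T = e_K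
π(a)` is `e_Kl π(a)`, and its powers are `e_Kl π(a ^ m)`. As `Kl ≤ S`, the map `π^K → π_S`
intertwines `T` with `a`. It is surjective, since large powers of `a` make any given vector
`Kr`-fixed, and `T` is nilpotent on its kernel, since large powers of `a` contract into `Kl` the
groups that kill the kernel. So `π_S` is finite-dimensional and the two traces agree. -/

namespace TreeCharacter

/-! ### Metric geometry of trees and projection to a line. -/

section Tree

variable {V : Type*} {X : SimpleGraph V}

/-- A geodesic from `x` to `w` followed by the edge to `v` is the unique path from `x` to `v`, so
`w` is its penultimate vertex. -/
theorem eq_of_adj_of_dist_lt (hX : X.IsTree) {x v w w' : V} (h : X.Adj v w) (h' : X.Adj v w')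
    (hd : X.dist x w < X.dist x v) (hd' : X.dist x w' < X.dist x v) : w = w' := by
  have key : ∀ {w : V}, X.Adj v w → X.dist x w < X.dist x v →
      ∃ p : X.Walk x v, p.IsPath ∧ p.penultimate = w := by
    intro w h hd
    obtain ⟨p, -, hp⟩ := hX.connected.exists_path_of_dist x w
    refine ⟨p.concat h.symm, ?_, by simp⟩
    apply SimpleGraph.Walk.isPath_of_length_eq_dist
    rw [SimpleGraph.Walk.length_concat, hp]
    rcases hX.dist_eq_dist_add_one_of_adj x h with h1 | h1 <;> omega
  obtain ⟨p, hp, rfl⟩ := key h hd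
  obtain ⟨p', hp', rfl⟩ := key h' hd'
  have := congrArg Subtype.val ((hX.isAcyclic.subsingleton_path x v).elim ⟨p, hp⟩ ⟨p', hp'⟩)
  simp only at this
  rw [this]

/-- The local form of "no backtracking implies geodesic"; it drives the inductions on distance
below. -/
theorem dist_eq_succ_of_ne (hX : X.IsTree) {x v w w' : V} (h : X.Adj v w) (h' : X.Adj v w')
    (hd : X.dist x w < X.dist x v) (hne : w' ≠ w) : X.dist x w' = X.dist x v + 1 := by
  rcases hX.dist_eq_dist_add_one_of_adj x h' with h1 | h1
  · exact absurd (eq_of_adj_of_dist_lt hX h' h (by omega) hd) hne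
  · exact h1

theorem exists_adj_dist_succ (hX : X.IsTree) {x v : V} (hne : x ≠ v) :
    ∃ w, X.Adj v w ∧ X.dist x w + 1 = X.dist x v := by
  obtain ⟨p, hp, hl⟩ := hX.connected.exists_path_of_dist v x
  cases p with
  | nil => exact absurd rfl hne
  | cons h p =>
    refine ⟨_, h, ?_⟩
    rw [SimpleGraph.Walk.length_cons, SimpleGraph.dist_comm] at hl
    have h1 := SimpleGraph.dist_le p
    rw [SimpleGraph.dist_comm] at h1
    rcases hX.dist_eq_dist_add_one_of_adj x h with h2 | h2 <;> omega

theorem dist_geodesic (hX : X.IsTree) (s : ℕ → V) (hadj : ∀ j, X.Adj (s j) (s (j + 1)))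
    (hnb : ∀ j, s j ≠ s (j + 2)) (k : ℕ) : X.dist (s 0) (s k) = k := by
  -- Two consecutive distances are carried along, so that the previous vertex is known to be the
  -- nearer neighbour.
  have : X.dist (s 0) (s k) = k ∧ X.dist (s 0) (s (k + 1)) = k + 1 := by
    induction k with
    | zero => simpa using hadj 0
    | succ k ih =>
      refine ⟨ih.2, ?_⟩
      have := dist_eq_succ_of_ne hX (x := s 0) (hadj k).symm (hadj (k + 1)) (by omega)
        (hnb k).symm
      rw [this, ih.2]
  exact this.1

theorem dist_map (hX : X.IsTree) (g : Aut X) (u v : V) : X.dist (g u) (g v) = X.dist u v := by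
  have key : ∀ (g : Aut X) (u v : V), X.dist (g u) (g v) ≤ X.dist u v := by
    intro g u v
    obtain ⟨p, -, hp⟩ := hX.connected.exists_path_of_dist u v
    rw [← hp, ← SimpleGraph.Walk.length_map g.toHom p]
    exact SimpleGraph.dist_le _
  refine le_antisymm (key g u v) ?_
  have := key g⁻¹ (g u) (g v)
  rwa [RelIso.inv_apply_self, RelIso.inv_apply_self] at this

theorem dist_triangle' (hX : X.IsTree) (u v w : V) : X.dist u w ≤ X.dist u v + X.dist v w :=
  hX.connected.dist_triangle

namespace Line

theorem dist_vert_vert (hX : X.IsTree) (l : Line X) (i j : ℤ) :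
    X.dist (l.vert i) (l.vert j) = (j - i).natAbs := by
  have key : ∀ (i : ℤ) (k : ℕ), X.dist (l.vert i) (l.vert (i + k)) = k := by
    intro i k
    have := dist_geodesic hX (fun k : ℕ => l.vert (i + k))
      (fun j => by simpa [add_assoc] using l.adj (i + j))
      (fun j => by simpa [add_assoc] using l.noBacktrack (i + j)) k
    simpa using this
  rcases le_total i j with h | h
  · have := key i (j - i).natAbs
    rwa [show i + ((j - i).natAbs : ℤ) = j by omega] at this
  · have := key j (j - i).natAbs
    rwa [show j + ((j - i).natAbs : ℤ) = i by omega, SimpleGraph.dist_comm] at this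

theorem vert_injective (hX : X.IsTree) (l : Line X) : Function.Injective l.vert := by
  intro i j h
  have := l.dist_vert_vert hX i j
  rw [h, SimpleGraph.dist_self] at this
  omega

/-- The index of the vertex of the line nearest to `u`. -/
noncomputable def proj (l : Line X) (u : V) : ℤ :=
  Classical.epsilon fun i =>
    ∀ j, X.dist u (l.vert j) = X.dist u (l.vert i) + (j - i).natAbs

/-- The distance of `u` from the line. -/
noncomputable def depth (l : Line X) (u : V) : ℕ := X.dist u (l.vert (l.proj u))

/-- From an index of least distance the first step in either direction must increase the distance;
after that, absence of backtracking keeps it growing by one. -/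
theorem exists_proj (hX : X.IsTree) (l : Line X) (u : V) :
    ∃ i, ∀ j, X.dist u (l.vert j) = X.dist u (l.vert i) + (j - i).natAbs := by
  obtain ⟨i, hi⟩ : ∃ i, ∀ j, X.dist u (l.vert i) ≤ X.dist u (l.vert j) := by
    obtain ⟨i, -, hi⟩ := WellFounded.has_min
      (InvImage.wf (fun i => X.dist u (l.vert i)) Nat.lt_wfRel.wf) Set.univ ⟨0, trivial⟩
    exact ⟨i, fun j => not_lt.1 (hi j trivial)⟩
  have up : ∀ k : ℕ, X.dist u (l.vert (i + k)) = X.dist u (l.vert i) + k ∧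
      X.dist u (l.vert (i + k + 1)) = X.dist u (l.vert i) + k + 1 := by
    intro k
    induction k with
    | zero =>
      refine ⟨by simp, ?_⟩
      have h1 := hi (i + 1)
      rcases hX.dist_eq_dist_add_one_of_adj u (l.adj i) with h | h
      · omega
      · simpa using h
    | succ k ih =>
      have h := dist_eq_succ_of_ne hX (x := u) (l.adj (i + k)).symm (l.adj (i + k + 1)) (by omega)
        (by simpa [add_assoc] using (l.noBacktrack (i + k)).symm)
      push_cast
      rw [← add_assoc]
      exact ⟨ih.2, by rw [h, ih.2]; rfl⟩
  have down : ∀ k : ℕ, X.dist u (l.vert (i - k)) = X.dist u (l.vert i) + k ∧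
      X.dist u (l.vert (i - k - 1)) = X.dist u (l.vert i) + k + 1 := by
    intro k
    induction k with
    | zero =>
      refine ⟨by simp, ?_⟩
      have h1 := hi (i - 1)
      have h2 := l.adj (i - 1)
      rw [sub_add_cancel] at h2
      rcases hX.dist_eq_dist_add_one_of_adj u h2 with h | h
      · simpa using h
      · omega
    | succ k ih =>
      have h2 := l.adj (i - k - 1)
      have h3 := l.adj (i - k - 2)
      have h4 := l.noBacktrack (i - k - 2)
      rw [sub_add_cancel] at h2 h4
      rw [show i - k - 2 + 1 = i - k - 1 by ring] at h3
      have h := dist_eq_succ_of_ne hX (x := u) h2 h3.symm (by omega) h4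
      push_cast
      rw [show i - (k + 1 : ℤ) = i - k - 1 by ring, show i - k - 1 - 1 = i - (k : ℤ) - 2 by ring]
      exact ⟨ih.2, by rw [h, ih.2]; rfl⟩
  refine ⟨i, fun j => ?_⟩
  rcases le_total i j with h | h
  · have := (up (j - i).natAbs).1
    rwa [show i + ((j - i).natAbs : ℤ) = j by omega] at this
  · have := (down (j - i).natAbs).1
    rwa [show i - ((j - i).natAbs : ℤ) = j by omega] at this

theorem dist_vert (hX : X.IsTree) (l : Line X) (u : V) (j : ℤ) :
    X.dist u (l.vert j) = l.depth u + (j - l.proj u).natAbs :=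
  Classical.epsilon_spec (l.exists_proj hX u) j

theorem proj_eq (hX : X.IsTree) (l : Line X) {u : V} {i : ℤ} {d : ℕ}
    (h : ∀ j, X.dist u (l.vert j) = d + (j - i).natAbs) : l.proj u = i ∧ l.depth u = d := by
  have h1 := h i
  have h2 := h (l.proj u)
  have h3 := l.dist_vert hX u i
  have h4 := l.dist_vert hX u (l.proj u)
  omega

theorem proj_vert (hX : X.IsTree) (l : Line X) (i : ℤ) : l.proj (l.vert i) = i :=
  (l.proj_eq hX (d := 0) fun j => by rw [l.dist_vert_vert hX, zero_add]).1

theorem depth_vert (hX : X.IsTree) (l : Line X) (i : ℤ) : l.depth (l.vert i) = 0 :=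
  (l.proj_eq hX (i := i) (d := 0) fun j => by rw [l.dist_vert_vert hX, zero_add]).2

theorem eq_vert_of_depth (hX : X.IsTree) (l : Line X) {u : V} (h : l.depth u = 0) :
    u = l.vert (l.proj u) :=
  (hX.connected u _).dist_eq_zero_iff.1 h

/-- The distances to the vertices of a line determine projection and depth, and automorphisms
preserve distances. The isometry `e` of `ℤ` covers both shifts and reversals. -/
theorem proj_map (hX : X.IsTree) (l m : Line X) {g : Aut X} (e : ℤ ≃ ℤ)
    (he : ∀ i j, (e i - e j).natAbs = (i - j).natAbs) (h : ∀ j, g (l.vert j) = m.vert (e j))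
    (u : V) : m.proj (g u) = e (l.proj u) ∧ m.depth (g u) = l.depth u := by
  refine m.proj_eq hX fun j => ?_
  obtain ⟨j, rfl⟩ := e.surjective j
  rw [← h, dist_map hX, l.dist_vert hX, he]

theorem proj_translation (hX : X.IsTree) (l : Line X) {g : Aut X} {n : ℤ}
    (h : ∀ j, g (l.vert j) = l.vert (j - n)) (u : V) :
    l.proj (g u) = l.proj u - n ∧ l.depth (g u) = l.depth u :=
  l.proj_map hX l (Equiv.subRight n) (fun i j => by simp) h u

theorem adj_cases (hX : X.IsTree) (l : Line X) {u w : V} (h : X.Adj u w) :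
    (l.proj u = l.proj w ∧ (l.depth u = l.depth w + 1 ∨ l.depth w = l.depth u + 1)) ∨
    (l.depth u = 0 ∧ l.depth w = 0 ∧ (l.proj w = l.proj u + 1 ∨ l.proj u = l.proj w + 1)) := by
  have hu := l.dist_vert hX u
  have hw := l.dist_vert hX w
  have hd : ∀ j, X.dist u (l.vert j) = X.dist w (l.vert j) + 1 ∨
      X.dist w (l.vert j) = X.dist u (l.vert j) + 1 := by
    intro j
    have := hX.dist_eq_dist_add_one_of_adj (l.vert j) h
    rwa [SimpleGraph.dist_comm, SimpleGraph.dist_comm (u := l.vert j) (v := w)] at this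
  by_cases hi : l.proj u = l.proj w
  · left
    refine ⟨hi, ?_⟩
    have := hd (l.proj u)
    have h1 := hu (l.proj u)
    have h2 := hw (l.proj u)
    omega
  · right
    have key : ∀ {u w : V}, X.Adj u w → (∀ j, X.dist u (l.vert j) = l.depth u + (j - l.proj u).natAbs)
        → (∀ j, X.dist w (l.vert j) = l.depth w + (j - l.proj w).natAbs) →
        l.depth u = l.depth w → l.proj u ≠ l.proj w → l.depth w = 0 := by
      intro u w h hu hw hd hi
      by_contra h0
      obtain ⟨w', hw', hlt⟩ := exists_adj_dist_succ hX (x := l.vert (l.proj w)) (v := w) (by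
        intro he
        apply h0
        rw [← he, l.depth_vert hX])
      have h1 := hu (l.proj u)
      have h2 := hw (l.proj u)
      have h3 := hu (l.proj w)
      have h4 := hw (l.proj w)
      have h5 := dist_triangle' hX (l.vert (l.proj u)) (l.vert (l.proj w)) w'
      rw [l.dist_vert_vert hX] at h5
      rw [SimpleGraph.dist_comm] at h1 h2 h3 h4
      have : u = w' := eq_of_adj_of_dist_lt hX h.symm hw' (x := l.vert (l.proj u))
        (by omega) (by omega)
      subst this
      omega
    have e1 := hd (l.proj u)
    have e2 := hd (l.proj w)
    -- This index and the next lie beyond both projections, one on each side. There the absolute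
    -- values open with known signs, and the two relations force equal depths and projections that
    -- differ by one.
    have e3 := hd (l.proj u + l.proj w + (l.proj u).natAbs + (l.proj w).natAbs)
    have e4 := hd (l.proj u + l.proj w - (l.proj u).natAbs - (l.proj w).natAbs)
    rw [hu, hw] at e1 e2 e3 e4
    have h1 : l.depth u = l.depth w := by omega
    have h2 := key h hu hw h1 hi
    refine ⟨h1.trans h2, h2, ?_⟩
    omega

theorem proj_eq_of_adj (hX : X.IsTree) (l : Line X) {u w : V} (h : X.Adj u w)
    (h0 : l.depth u ≠ 0) : l.proj w = l.proj u := by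
  have := l.adj_cases hX h
  omega

/-- A vertex off the line has a unique neighbour that is nearer to the line. -/
theorem exists_parent (hX : X.IsTree) (l : Line X) {u : V} (h0 : l.depth u ≠ 0) :
    ∃ w, X.Adj u w ∧ l.depth u = l.depth w + 1 ∧ l.proj w = l.proj u ∧
      ∀ w', X.Adj u w' → w' ≠ w → l.depth w' = l.depth u + 1 := by
  obtain ⟨w, hw, hlt⟩ := exists_adj_dist_succ hX (x := l.vert (l.proj u)) (v := u) (by
        intro he
        apply h0
        rw [← he, l.depth_vert hX])
  have key : ∀ {w}, X.Adj u w → X.dist (l.vert (l.proj u)) w = l.depth w := by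
    intro w hw
    rw [← l.proj_eq_of_adj hX hw h0, SimpleGraph.dist_comm]
    rfl
  rw [key hw, SimpleGraph.dist_comm] at hlt
  change _ = l.depth u at hlt
  refine ⟨w, hw, by omega, l.proj_eq_of_adj hX hw h0, fun w' hw' hne => ?_⟩
  have h1 : X.dist (l.vert (l.proj u)) u = l.depth u := SimpleGraph.dist_comm
  have := dist_eq_succ_of_ne hX (x := l.vert (l.proj u)) hw hw' (by rw [key hw, h1]; omega) hne
  rwa [key hw', h1] at this

/-- Induction on the depth of `u`: its parent has a neighbour nearer to `w`, on the line or one step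
closer to it, and this is not `u`. So `u` is one step farther from `w` than its parent. -/
theorem dist_eq_of_proj_ne (hX : X.IsTree) (l : Line X) {u w : V} (h : l.proj u ≠ l.proj w) :
    X.dist u w = l.depth u + (l.proj u - l.proj w).natAbs + l.depth w := by
  induction hd : l.depth u using Nat.strong_induction_on generalizing u with
  | _ d ih =>
  rcases Nat.eq_zero_or_pos d with rfl | hpos
  · rw [l.eq_vert_of_depth hX hd, SimpleGraph.dist_comm, l.dist_vert hX, l.proj_vert hX]
    omega
  · obtain ⟨u', hu', hd', hp', -⟩ := l.exists_parent hX (u := u) (by omega)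
    have h1 := ih (l.depth u') (by omega) (u := u') (by rwa [hp']) rfl
    rw [hp'] at h1
    suffices hs : ∃ u'', X.Adj u' u'' ∧ X.dist w u'' < X.dist w u' ∧ u ≠ u'' by
      obtain ⟨u'', ha, hlt, hne⟩ := hs
      have := dist_eq_succ_of_ne hX ha hu'.symm hlt hne
      rw [SimpleGraph.dist_comm, this, SimpleGraph.dist_comm, h1]
      omega
    by_cases h0 : l.depth u' = 0
    · have hv := l.eq_vert_of_depth hX h0
      rw [hp'] at hv
      have hww : ∀ j, X.dist w (l.vert j) = _ := l.dist_vert hX w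
      have hne : ∀ j, u ≠ l.vert j := by
        rintro j rfl
        rw [l.depth_vert hX] at hd
        omega
      rcases lt_or_gt_of_ne h with hlt | hlt
      · refine ⟨l.vert (l.proj u + 1), hv ▸ l.adj _, ?_, hne _⟩
        rw [hv, hww, hww]
        omega
      · refine ⟨l.vert (l.proj u - 1), ?_, ?_, hne _⟩
        · have := l.adj (l.proj u - 1)
          rw [sub_add_cancel, ← hv] at this
          exact this.symm
        · rw [hv, hww, hww]
          omega
    · obtain ⟨u'', hu'', hd'', hp'', -⟩ := l.exists_parent hX h0
      have h2 := ih (l.depth u'') (by omega) (u := u'') (by rwa [hp'', hp']) rfl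
      refine ⟨u'', hu'', ?_, ?_⟩
      · rw [SimpleGraph.dist_comm, h2, SimpleGraph.dist_comm, h1, hp'', hp']
        omega
      · rintro rfl
        omega

end Line

end Tree
end TreeCharacter

namespace TreeCharacter

/-! ### Constructing automorphisms of a regular tree by extension and gluing. -/

section Automorphisms

variable {V : Type*} {X : SimpleGraph V} [X.LocallyFinite] {q : ℕ}

/-- A locally injective endomorphism of a regular tree is an automorphism. -/
theorem exists_aut_of_injOn_neighborSet (hX : X.IsTree) (hreg : X.IsRegularOfDegree (q + 1))
    (φ : V → V) (hadj : ∀ u v, X.Adj u v → X.Adj (φ u) (φ v))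
    (hinj : ∀ v, Set.InjOn φ (X.neighborSet v)) : ∃ g : Aut X, ∀ u, g u = φ u := by
  classical
  -- Equal finite degrees turn local injectivity into local surjectivity.
  have hloc : ∀ v w, X.Adj (φ v) w → ∃ u, X.Adj v u ∧ φ u = w := by
    intro v w hw
    have h1 : (X.neighborFinset v).image φ = X.neighborFinset (φ v) := by
      apply Finset.eq_of_subset_of_card_le
      · intro x hx
        obtain ⟨u, hu, rfl⟩ := Finset.mem_image.1 hx
        rw [SimpleGraph.mem_neighborFinset] at hu ⊢
        exact hadj _ _ hu
      · rw [Finset.card_image_of_injOn (by simpa using hinj v), SimpleGraph.card_neighborFinset_eq_degree,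
          SimpleGraph.card_neighborFinset_eq_degree, hreg, hreg]
    have h2 : w ∈ (X.neighborFinset v).image φ := by
      rw [h1, SimpleGraph.mem_neighborFinset]
      exact hw
    obtain ⟨u, hu, rfl⟩ := Finset.mem_image.1 h2
    exact ⟨u, by simpa using hu, rfl⟩
  -- Local injectivity keeps the image of a geodesic free of backtracking.
  have hdist : ∀ k, ∀ u v, X.dist u v = k → X.dist (φ u) (φ v) = k := by
    intro k
    induction k using Nat.strong_induction_on with
    | _ k ih =>
    intro u v hk
    rcases k with _ | k
    · have : u = v := (hX.connected u v).dist_eq_zero_iff.1 hk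
      rw [this, SimpleGraph.dist_self]
    · obtain ⟨v', hv', hd'⟩ := exists_adj_dist_succ hX (x := u) (v := v) (by
        rintro rfl
        simp at hk)
      rcases k with _ | k
      · have : u = v' := (hX.connected u v').dist_eq_zero_iff.1 (by omega)
        subst this
        simpa using hadj _ _ hv'.symm
      · obtain ⟨v'', hv'', hd''⟩ := exists_adj_dist_succ hX (x := u) (v := v') (by
          rintro rfl
          rw [SimpleGraph.dist_self] at hd'
          omega)
        have h1 := ih (k + 1) (by omega) u v' (by omega)
        have h2 := ih k (by omega) u v'' (by omega)
        have hne : φ v ≠ φ v'' := fun h => by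
          have := hinj v' hv'.symm hv'' h
          rw [this] at hk hd'
          omega
        rw [dist_eq_succ_of_ne hX (hadj _ _ hv'') (hadj _ _ hv'.symm) (by omega) hne, h1]
  have hi : Function.Injective φ := fun u v h => by
    have := hdist _ u v rfl
    rw [h, SimpleGraph.dist_self] at this
    exact (hX.connected u v).dist_eq_zero_iff.1 this.symm
  have hs : Function.Surjective φ := by
    obtain ⟨o⟩ := hX.connected.nonempty
    intro w
    obtain ⟨p⟩ := hX.connected (φ o) w
    have key : ∀ {a b : V}, X.Walk a b → (∃ u, φ u = a) → ∃ u, φ u = b := by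
      intro a b p
      induction p with
      | nil => exact id
      | cons h p ih =>
        rintro ⟨u, rfl⟩
        obtain ⟨u', -, hu'⟩ := hloc _ _ h
        exact ih ⟨u', hu'⟩
    exact key p ⟨o, rfl⟩
  refine ⟨⟨Equiv.ofBijective φ ⟨hi, hs⟩, ?_⟩, fun u => rfl⟩
  intro a b
  refine ⟨fun h => ?_, hadj a b⟩
  rw [← SimpleGraph.dist_eq_one_iff_adj] at h ⊢
  rw [← h]
  exact (hdist _ a b rfl).symm

/-- Both stars have `q + 1` leaves, so a partial injection between them extends to a bijection. -/
theorem exists_local_extension (hreg : X.IsRegularOfDegree (q + 1)) (v w : V) (s : Set V)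
    (f : V → V) (hs : s ⊆ X.neighborSet v) (hf : ∀ u ∈ s, X.Adj w (f u)) (hinj : s.InjOn f) :
    ∃ β : V → V, (∀ u, X.Adj v u → X.Adj w (β u)) ∧ Set.InjOn β (X.neighborSet v) ∧
      ∀ u ∈ s, β u = f u := by
  classical
  obtain ⟨g, hg⟩ := Finset.exists_equiv_extend_of_card_eq (α := X.neighborSet v)
    (t := X.neighborFinset w) (s := Finset.univ.filter fun u => (u : V) ∈ s)
    (f := fun u => f u) (by
      rw [SimpleGraph.card_neighborSet_eq_degree, SimpleGraph.card_neighborFinset_eq_degree, hreg,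
        hreg]) (by
      intro x hx
      obtain ⟨u, hu, rfl⟩ := Finset.mem_image.1 hx
      rw [SimpleGraph.mem_neighborFinset]
      exact hf _ (by simpa using hu)) (by
      intro a ha b hb hab
      exact Subtype.ext (hinj (by simpa using ha) (by simpa using hb) hab))
  refine ⟨fun u => if h : X.Adj v u then g ⟨u, h⟩ else u, ?_, ?_, ?_⟩
  · intro u hu
    simp only [hu, dite_true]
    rw [← SimpleGraph.mem_neighborFinset]
    exact (g ⟨u, hu⟩).2
  · intro a ha b hb hab
    rw [SimpleGraph.mem_neighborSet] at ha hb
    simp only [ha, hb, dite_true] at hab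
    exact congrArg Subtype.val (g.injective (Subtype.ext hab))
  · intro u hu
    have : X.Adj v u := hs hu
    simp only [this, dite_true]
    exact hg ⟨u, this⟩ (by simpa using hu)

/-- Extension of a map between two lines along given local extensions. -/
noncomputable def Line.extend (l m : Line X) (par : V → V) (β₀ : ℤ → V → V)
    (β : V → V → V → V → V → V)
    (hpar : ∀ u, l.depth u ≠ 0 → l.depth (par u) < l.depth u) (u : V) : V :=
  if _h0 : l.depth u = 0 then m.vert (l.proj u)
  else if _h1 : l.depth (par u) = 0 then β₀ (l.proj u) u
  else β (par u) (par (par u)) (Line.extend l m par β₀ β hpar (par u))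
    (Line.extend l m par β₀ β hpar (par (par u))) u
termination_by l.depth u
decreasing_by
  · exact hpar u _h0
  · exact (hpar _ _h1).trans (hpar u _h0)

/-- The automorphism group acts transitively on parametrized lines. -/
theorem exists_aut_line (hX : X.IsTree) (hreg : X.IsRegularOfDegree (q + 1)) (l m : Line X) :
    ∃ g : Aut X, ∀ j, g (l.vert j) = m.vert j := by
  classical
  have hβ₀ : ∀ j : ℤ, ∃ β : V → V, (∀ u, X.Adj (l.vert j) u → X.Adj (m.vert j) (β u)) ∧
      Set.InjOn β (X.neighborSet (l.vert j)) ∧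
      ∀ u, X.Adj (l.vert j) u → l.depth u = 0 → β u = m.vert (l.proj u) := by
    intro j
    have hcases : ∀ u, X.Adj (l.vert j) u → l.depth u = 0 →
        (l.proj u = j + 1 ∨ l.proj u + 1 = j) := by
      intro u hu h0
      have := l.adj_cases hX hu
      rw [l.depth_vert hX, l.proj_vert hX] at this
      omega
    obtain ⟨β, h1, h2, h3⟩ := exists_local_extension hreg (l.vert j) (m.vert j)
      {u | X.Adj (l.vert j) u ∧ l.depth u = 0} (fun u => m.vert (l.proj u)) (fun u hu => hu.1)
      (by
        rintro u ⟨hu, h0⟩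
        rcases hcases u hu h0 with h | h
        · rw [h]
          exact m.adj j
        · rw [← h]
          exact (m.adj _).symm)
      (by
        rintro u ⟨hu, h0⟩ u' ⟨hu', h0'⟩ he
        rw [l.eq_vert_of_depth hX h0, l.eq_vert_of_depth hX h0', m.vert_injective hX he])
    exact ⟨β, h1, h2, fun u hu h0 => h3 u ⟨hu, h0⟩⟩
  choose β₀ hβ1 hβ2 hβ3 using hβ₀
  -- The local map at a vertex `v` off the line is used with `p` the parent of `v` and `p'` the
  -- image already assigned to it, so that it agrees with the earlier stage.
  have hβ : ∀ v p w p' : V, ∃ β : V → V, X.Adj v p → X.Adj w p' →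
      (∀ u, X.Adj v u → X.Adj w (β u)) ∧ Set.InjOn β (X.neighborSet v) ∧ β p = p' := by
    intro v p w p'
    by_cases h : X.Adj v p ∧ X.Adj w p'
    · obtain ⟨β, h1, h2, h3⟩ := exists_local_extension hreg v w {p} (fun _ => p')
        (by simpa using h.1) (by simpa using h.2) (by simp)
      exact ⟨β, fun _ _ => ⟨h1, h2, h3 p rfl⟩⟩
    · exact ⟨id, fun h1 h2 => absurd ⟨h1, h2⟩ h⟩
  choose β hβ using hβ
  have hpar : ∀ u, ∃ w, l.depth u ≠ 0 → (X.Adj u w ∧ l.depth u = l.depth w + 1 ∧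
      l.proj w = l.proj u ∧ ∀ w', X.Adj u w' → w' ≠ w → l.depth w' = l.depth u + 1) := by
    intro u
    by_cases h : l.depth u = 0
    · exact ⟨u, fun h' => absurd h h'⟩
    · obtain ⟨w, hw⟩ := l.exists_parent hX h
      exact ⟨w, fun _ => hw⟩
  choose par hpar using hpar
  have hlt : ∀ u, l.depth u ≠ 0 → l.depth (par u) < l.depth u := fun u h => by
    have := (hpar u h).2.1
    omega
  obtain ⟨φ, hφ⟩ : ∃ φ, φ = l.extend m par β₀ β hlt := ⟨_, rfl⟩
  have hφ0 : ∀ u, l.depth u = 0 → φ u = m.vert (l.proj u) := by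
    intro u h
    rw [hφ, Line.extend, dif_pos h]
  have hφ1 : ∀ u, l.depth u ≠ 0 → l.depth (par u) = 0 → φ u = β₀ (l.proj u) u := by
    intro u h h'
    rw [hφ, Line.extend, dif_neg h, dif_pos h']
  have hφ2 : ∀ u, l.depth u ≠ 0 → l.depth (par u) ≠ 0 →
      φ u = β (par u) (par (par u)) (φ (par u)) (φ (par (par u))) u := by
    intro u h h'
    rw [hφ]
    conv_lhs => rw [Line.extend, dif_neg h, dif_neg h']
  have hup : ∀ d u, l.depth u = d → l.depth u ≠ 0 → X.Adj (φ (par u)) (φ u) := by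
    intro d
    induction d using Nat.strong_induction_on with
    | _ d ih =>
    intro u hd h0
    by_cases h1 : l.depth (par u) = 0
    · rw [hφ1 u h0 h1, hφ0 _ h1, (hpar u h0).2.2.1]
      apply hβ1
      rw [← (hpar u h0).2.2.1, ← l.eq_vert_of_depth hX h1]
      exact (hpar u h0).1.symm
    · rw [hφ2 u h0 h1]
      exact (hβ _ _ _ _ (hpar _ h1).1
        (ih (l.depth (par u)) (hd ▸ hlt u h0) _ rfl h1).symm).1 _ (hpar u h0).1.symm
  have hpar' : ∀ v u, X.Adj v u → l.depth v < l.depth u → par u = v := by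
    intro v u h hvu
    by_contra hne
    have := (hpar u (by omega)).2.2.2 v h.symm (Ne.symm hne)
    omega
  -- On each star `φ` coincides with one of the chosen local maps, which gives adjacency and local
  -- injectivity together.
  have hloc : ∀ v, (∀ u, X.Adj v u → X.Adj (φ v) (φ u)) ∧ Set.InjOn φ (X.neighborSet v) := by
    intro v
    suffices h : ∃ b : V → V, (∀ u, X.Adj v u → X.Adj (φ v) (b u)) ∧
        Set.InjOn b (X.neighborSet v) ∧ ∀ u, X.Adj v u → φ u = b u by
      obtain ⟨b, h1, h2, h3⟩ := h
      refine ⟨fun u hu => by rw [h3 u hu]; exact h1 u hu, fun u hu u' hu' he => h2 hu hu' ?_⟩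
      rwa [← h3 u hu, ← h3 u' hu']
    by_cases h0 : l.depth v = 0
    · have hv := l.eq_vert_of_depth hX h0
      refine ⟨β₀ (l.proj v), ?_, ?_, ?_⟩
      · intro u hu
        rw [hφ0 v h0]
        apply hβ1
        rwa [← hv]
      · have := hβ2 (l.proj v)
        rwa [← hv] at this
      · intro u hu
        by_cases hu0 : l.depth u = 0
        · rw [hφ0 u hu0, hβ3 _ _ (by rwa [← hv]) hu0]
        · have hp := hpar' v u hu (by omega)
          rw [hφ1 u hu0 (by rw [hp, h0]), ← (hpar u hu0).2.2.1, hp]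
    · have hv := hpar v h0
      have hb := hβ _ _ _ _ hv.1 (hup _ v rfl h0).symm
      refine ⟨_, hb.1, hb.2.1, fun u hu => ?_⟩
      by_cases hup : u = par v
      · rw [hup, hb.2.2]
      · have hd := hv.2.2.2 u hu hup
        have hp := hpar' v u hu (by omega)
        rw [hφ2 u (by omega) (by rw [hp]; exact h0), hp]
  obtain ⟨g, hg⟩ := exists_aut_of_injOn_neighborSet hX hreg φ (fun u v => (hloc u).1 v)
    fun v => (hloc v).2
  exact ⟨g, fun j => by rw [hg, hφ0 _ (l.depth_vert hX j), l.proj_vert hX]⟩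

/-- Automorphisms that agree on consecutive edges of a line can be glued. -/
theorem exists_aut_glue (hX : X.IsTree) (hreg : X.IsRegularOfDegree (q + 1)) (l : Line X)
    (γ : ℤ → Aut X) (h0 : ∀ j, γ j (l.vert j) = γ (j + 1) (l.vert j))
    (h1 : ∀ j, γ j (l.vert (j + 1)) = γ (j + 1) (l.vert (j + 1))) :
    ∃ g : Aut X, ∀ u, g u = γ (l.proj u) u := by
  -- Neighbours with different projections both lie on the line, where the consecutive automorphisms
  -- agree; so on each star the glued map is a single automorphism.
  have key : ∀ v u, X.Adj v u → γ (l.proj u) u = γ (l.proj v) u := by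
    intro v u h
    rcases l.adj_cases hX h with hc | ⟨hv, hu, hc | hc⟩
    · rw [hc.1]
    · rw [l.eq_vert_of_depth hX hu, l.proj_vert hX, hc, h1]
    · rw [l.eq_vert_of_depth hX hu, l.proj_vert hX, hc, h0]
  apply exists_aut_of_injOn_neighborSet hX hreg (fun u => γ (l.proj u) u)
  · intro u v h
    simp only [key u v h]
    exact (γ _).map_adj_iff.2 h
  · intro v a ha b hb hab
    simp only [key v a ha, key v b hb] at hab
    exact (γ _).injective hab

/-- Two hyperbolic automorphisms that translate a line in the same way are conjugate. -/
theorem exists_conj_of_translation (hX : X.IsTree) (hreg : X.IsRegularOfDegree (q + 1))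
    (l : Line X) {n : ℤ} (hn : 0 < n) {a y : Aut X} (ha : ∀ j, a (l.vert j) = l.vert (j - n))
    (hy : ∀ j, y (l.vert j) = l.vert (j - n)) :
    ∃ h : Aut X, (∀ j, h (l.vert j) = l.vert j) ∧ h * a * h⁻¹ = y := by
  have hpow : ∀ {b : Aut X}, (∀ j, b (l.vert j) = l.vert (j - n)) →
      ∀ (k j : ℤ), (b ^ k) (l.vert j) = l.vert (j - k * n) := by
    intro b hb k
    induction k with
    | zero => intro j; simp
    | succ i ih =>
      intro j
      rw [zpow_add_one, RelIso.mul_apply, hb, ih]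
      congr 1
      ring
    | pred i ih =>
      intro j
      have hb' : b⁻¹ (l.vert j) = l.vert (j + n) := by
        have := hb (j + n)
        rw [add_sub_cancel_right] at this
        rw [← this, RelIso.inv_apply_self]
      rw [zpow_sub_one, RelIso.mul_apply, hb', ih]
      congr 1
      ring
  have hfix : ∀ k j : ℤ, (y ^ k * a ^ (-k)) (l.vert j) = l.vert j := by
    intro k j
    rw [RelIso.mul_apply, hpow ha, hpow hy]
    congr 1
    ring
  -- On the `k`-th block of `n` branches the conjugator is `y ^ (-k) * a ^ k`. These maps fix the
  -- line, hence glue, and `a` lowers the block number by one, which gives `h * a = y * h`.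
  obtain ⟨h, hh⟩ := exists_aut_glue hX hreg l (fun i => y ^ (-(i / n)) * a ^ (-(-(i / n))))
    (fun j => by rw [hfix, hfix]) (fun j => by rw [hfix, hfix])
  refine ⟨h, fun j => by rw [hh, hfix], ?_⟩
  rw [mul_inv_eq_iff_eq_mul]
  ext u
  rw [RelIso.mul_apply, RelIso.mul_apply, hh, hh, (l.proj_translation hX ha u).1]
  have : (l.proj u - n) / n = l.proj u / n - 1 := by
    rw [Int.sub_ediv_of_dvd _ dvd_rfl, Int.ediv_self hn.ne']
  rw [this, ← RelIso.mul_apply, ← RelIso.mul_apply]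
  congr 1
  rw [mul_assoc, ← zpow_add_one, ← mul_assoc, ← zpow_one_add]
  ring_nf

/-- Reversal of a line, extended by the identity on the branches at a vertex of the line. -/
theorem exists_aut_reverse (hX : X.IsTree) (hreg : X.IsRegularOfDegree (q + 1)) (l : Line X)
    (i : ℤ) : ∃ g : Aut X, (∀ u, l.proj u = i → g u = u) ∧
      ∀ j, g (l.vert j) = l.vert (2 * i - j) := by
  classical
  obtain ⟨z, hz⟩ := exists_aut_line hX hreg l
    { vert := fun j => l.vert (2 * i - j)
      adj := fun j => by
        have := (l.adj (2 * i - (j + 1))).symm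
        rwa [show 2 * i - (j + 1) + 1 = 2 * i - j by ring] at this
      noBacktrack := fun j => by
        have := (l.noBacktrack (2 * i - (j + 2))).symm
        rwa [show 2 * i - (j + 2) + 2 = 2 * i - j by ring] at this }
  simp only at hz
  have hzi : z (l.vert i) = l.vert i := by
    rw [hz]
    congr 1
    ring
  have hpr := fun u => (l.proj_map hX l (Equiv.subLeft (2 * i)) (fun a b => by simp; omega) hz u).1
  simp only [Equiv.subLeft_apply] at hpr
  -- The branch at `i` is joined to the rest only through `l.vert i`, which `z` fixes; so the
  -- identity on the branch and `z` elsewhere fit together.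
  have hv : ∀ u w, X.Adj u w → l.proj u ≠ i → l.proj w = i → w = l.vert i := by
    intro u w h hu hw
    have h1 := l.adj_cases hX h
    rw [l.eq_vert_of_depth hX (u := w) (by omega), hw]
  obtain ⟨g, hg⟩ := exists_aut_of_injOn_neighborSet hX hreg
    (fun u => if l.proj u = i then u else z u) (by
      intro u w h
      split_ifs with hu hw hw
      · exact h
      · rw [hv w u h.symm hw hu, ← hzi]
        rw [hv w u h.symm hw hu] at h
        exact z.map_adj_iff.2 h
      · rw [hv u w h hu hw, ← hzi]
        rw [hv u w h hu hw] at h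
        exact z.map_adj_iff.2 h
      · exact z.map_adj_iff.2 h) (by
      intro v a ha b hb hab
      simp only at hab
      split_ifs at hab with h1 h2 h2
      · exact hab
      · have := hpr b
        rw [← hab] at this
        omega
      · have := hpr a
        rw [hab] at this
        omega
      · exact z.injective hab)
  refine ⟨g, fun u hu => by rw [hg, if_pos hu], fun j => ?_⟩
  rw [hg, l.proj_vert hX]
  split_ifs with h
  · congr 1
    omega
  · exact hz j

end Automorphisms
end TreeCharacter

namespace TreeCharacter

/-! ### Axes and translation lengths. -/

section Hyperbolic

variable {V : Type*} {X : SimpleGraph V}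

theorem Line.pow_translation (l : Line X) {a : Aut X} {n : ℤ}
    (ha : ∀ j, a (l.vert j) = l.vert (j - n)) (k : ℕ) (j : ℤ) :
    (a ^ k) (l.vert j) = l.vert (j - k * n) := by
  induction k generalizing j with
  | zero => simp
  | succ k ih =>
    rw [pow_succ, RelIso.mul_apply, ha, ih]
    congr 1
    push_cast
    ring

/-- The `k`-th power displaces `l.vert 0` by `k * n` and `m.vert 0` by `k * n'`. These differ by at
most twice the distance `d` of the two vertices, so `k = 2 * d + 1` excludes `n ≠ n'`. -/
theorem translation_length_unique (hX : X.IsTree) (l m : Line X) {a : Aut X} {n n' : ℤ}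
    (hn : 0 < n) (hn' : 0 < n') (hl : ∀ j, a (l.vert j) = l.vert (j - n))
    (hm : ∀ j, a (m.vert j) = m.vert (j - n')) : n = n' := by
  have key : ∀ (l m : Line X) {n n' : ℤ}, 0 < n → 0 < n' →
      (∀ j, a (l.vert j) = l.vert (j - n)) → (∀ j, a (m.vert j) = m.vert (j - n')) → n ≤ n' := by
    intro l m n n' hn hn' hl hm
    by_contra hlt
    push Not at hlt
    obtain ⟨d, hd⟩ : ∃ d, d = X.dist (l.vert 0) (m.vert 0) := ⟨_, rfl⟩
    have h1 := l.pow_translation hl (2 * d + 1) 0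
    have h2 := m.pow_translation hm (2 * d + 1) 0
    have h3 := l.dist_vert_vert hX 0 (0 - ((2 * d + 1 : ℕ) : ℤ) * n)
    have h4 := m.dist_vert_vert hX 0 (0 - ((2 * d + 1 : ℕ) : ℤ) * n')
    rw [← h1] at h3
    rw [← h2] at h4
    have h5 := dist_triangle' hX (l.vert 0) (m.vert 0) ((a ^ (2 * d + 1)) (l.vert 0))
    have h6 := dist_triangle' hX (m.vert 0) ((a ^ (2 * d + 1)) (m.vert 0))
      ((a ^ (2 * d + 1)) (l.vert 0))
    rw [dist_map hX, SimpleGraph.dist_comm (u := m.vert 0) (v := l.vert 0)] at h6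
    push_cast at h3 h4
    have h7 : (2 * (d : ℤ) + 1) * (n' + 1) ≤ (2 * (d : ℤ) + 1) * n :=
      mul_le_mul_of_nonneg_left (by omega) (by positivity)
    rw [mul_add, mul_one] at h7
    have h8 : 0 ≤ (2 * (d : ℤ) + 1) * n' := by positivity
    omega
  exact le_antisymm (key l m hn hn' hl hm) (key m l hn' hn hm hl)

/-- A translation shifts all projections to its line, so it fixes no vertex. If it swapped the ends
of an edge, its square, again a translation, would fix a vertex. -/
theorem mem_hyperbolicSet_of_translation (hX : X.IsTree) (l : Line X) {a : Aut X} {n : ℤ}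
    (hn : 0 < n) (hl : ∀ j, a (l.vert j) = l.vert (j - n)) : a ∈ hyperbolicSet X := by
  have key : ∀ {a : Aut X} {n : ℤ}, 0 < n → (∀ j, a (l.vert j) = l.vert (j - n)) →
      ∀ v, a v ≠ v := by
    intro a n hn hl v h
    have := (l.proj_translation hX hl v).1
    rw [h] at this
    omega
  rintro (⟨v, hv⟩ | ⟨e, he, hv⟩)
  · exact key hn hl v hv
  · induction e using Sym2.inductionOn with
    | hf u w =>
      have h2 : ∀ j, (a ^ 2) (l.vert j) = l.vert (j - 2 * n) := by
        simpa using l.pow_translation hl 2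
      rw [Sym2.map_mk, Sym2.eq_iff] at hv
      rcases hv with ⟨hu, -⟩ | ⟨hu, hw⟩
      · exact key hn hl u hu
      · refine key (by omega) h2 u ?_
        rw [pow_two, RelIso.mul_apply, hu, hw]

/-- A hyperbolic automorphism translates a line. -/
theorem exists_axis (hX : X.IsTree) {g : Aut X} (hg : g ∈ hyperbolicSet X) :
    ∃ (m : Line X) (n : ℤ), 0 < n ∧ ∀ j, g (m.vert j) = m.vert (j - n) := by
  have hgv : ∀ v, g v ≠ v := fun v hv => hg (Or.inl ⟨v, hv⟩)
  -- A vertex of least displacement lies on the axis, which is made of the `g⁻¹ ^ k`-translates of a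
  -- geodesic from `v` to `g⁻¹ v`. The inverse appears because `g` has to lower the index.
  obtain ⟨v, hv⟩ : ∃ v, ∀ w, X.dist v (g⁻¹ v) ≤ X.dist w (g⁻¹ w) := by
    obtain ⟨o⟩ := hX.connected.nonempty
    obtain ⟨i, -, hi⟩ := WellFounded.has_min
      (InvImage.wf (fun i => X.dist i (g⁻¹ i)) Nat.lt_wfRel.wf) Set.univ ⟨o, trivial⟩
    exact ⟨i, fun j => not_lt.1 (hi j trivial)⟩
  obtain ⟨p, -, hp⟩ := hX.connected.exists_path_of_dist v (g⁻¹ v)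
  obtain ⟨n, hn⟩ : ∃ n, n = p.length := ⟨_, rfl⟩
  obtain ⟨P, hP⟩ : ∃ P, P = p.getVert := ⟨_, rfl⟩
  have hP0 : P 0 = v := by rw [hP, SimpleGraph.Walk.getVert_zero]
  have hPn : P n = g⁻¹ v := by rw [hP, hn, SimpleGraph.Walk.getVert_length]
  have hadj : ∀ i < n, X.Adj (P i) (P (i + 1)) := fun i hi => by
    rw [hP]
    exact p.adj_getVert_succ (hn ▸ hi)
  have hle : ∀ i k, i + k ≤ n → X.dist (P i) (P (i + k)) ≤ k := by
    intro i k
    induction k with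
    | zero => simp
    | succ k ih =>
      intro h
      have h1 := ih (by omega)
      have h2 := dist_triangle' hX (P i) (P (i + k)) (P (i + k + 1))
      rw [SimpleGraph.dist_eq_one_iff_adj.2 (hadj (i + k) (by omega))] at h2
      rw [← add_assoc]
      omega
  have hdn : X.dist (P 0) (P n) = n := by rw [hP0, hPn, ← hp, hn]
  have hnpos : 0 < n := by
    rcases Nat.eq_zero_or_pos n with h | h
    · exfalso
      apply hgv v
      rw [h, hP0] at hPn
      conv_lhs => rw [hPn]
      rw [RelIso.apply_inv_self]
    · exact h
  have hnb : ∀ i, i + 2 ≤ n → P i ≠ P (i + 2) := by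
    intro i hi he
    have h1 := hle 0 i (by omega)
    have h2 := hle (i + 2) (n - (i + 2)) (by omega)
    rw [show i + 2 + (n - (i + 2)) = n by omega, ← he] at h2
    rw [zero_add] at h1
    have := dist_triangle' hX (P 0) (P i) (P n)
    omega
  -- Backtracking where two translates meet would give `P 1` a displacement of at most `n - 2` if `n
  -- > 1`, and would make `g` invert an edge if `n = 1`.
  have hjoin : P (n - 1) ≠ g⁻¹ (P 1) := by
    intro he
    rcases Nat.lt_or_ge 1 n with h1 | h1
    · have h2 := hv (P 1)
      have h3 := hle 1 (n - 2) (by omega)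
      rw [← he, ← hp, ← hn] at h2
      rw [show 1 + (n - 2) = n - 1 by omega] at h3
      omega
    · obtain rfl : n = 1 := by omega
      apply hg
      refine Or.inr ⟨s(P 0, P 1), hadj 0 (by omega), ?_⟩
      rw [Sym2.map_mk, Sym2.eq_iff]
      right
      constructor
      · rw [show P 0 = g⁻¹ (P 1) from he, RelIso.apply_inv_self]
      · rw [hPn, RelIso.apply_inv_self, hP0]
  obtain ⟨s, hs⟩ : ∃ s : ℤ → V, s = fun j => (g⁻¹ ^ (j / (n : ℤ))) (P (j % (n : ℤ)).toNat) := ⟨_, rfl⟩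
  have hs1 : ∀ (k : ℤ) (i : ℕ), i ≤ n → s (k * n + i) = (g⁻¹ ^ k) (P i) := by
    intro k i hi
    have hn0 : (n : ℤ) ≠ 0 := by omega
    rcases hi.lt_or_eq with h | rfl
    · rw [hs]
      simp only
      rw [add_comm, Int.add_mul_ediv_right _ _ hn0, Int.add_mul_emod_self_right,
        Int.ediv_eq_zero_of_lt (by omega) (by omega), Int.emod_eq_of_lt (by omega) (by omega)]
      simp
    · rw [hs]
      simp only
      rw [show k * (i : ℤ) + i = (k + 1) * i by ring, Int.mul_ediv_cancel _ hn0,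
        Int.mul_emod_left, zpow_add_one, RelIso.mul_apply, hPn]
      simp [hP0]
  have hdiv : ∀ j : ℤ, ∃ (k : ℤ) (i : ℕ), i < n ∧ j = k * n + i := by
    intro j
    have h1 := Int.emod_nonneg j (b := n) (by omega)
    have h2 := Int.emod_lt_of_pos j (b := n) (by omega)
    refine ⟨j / n, (j % n).toNat, by omega, ?_⟩
    rw [Int.toNat_of_nonneg h1, mul_comm, Int.mul_ediv_add_emod]
  refine ⟨⟨s, ?_, ?_⟩, n, by omega, ?_⟩
  · intro j
    obtain ⟨k, i, hi, rfl⟩ := hdiv j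
    rw [hs1 k i hi.le]
    have := hs1 k (i + 1) hi
    push_cast at this
    rw [add_assoc, this]
    exact (g⁻¹ ^ k).map_adj_iff.2 (hadj i hi)
  · intro j
    obtain ⟨k, i, hi, rfl⟩ := hdiv j
    rw [hs1 k i hi.le]
    rcases Nat.lt_or_ge (i + 1) n with h | h
    · have := hs1 k (i + 2) h
      push_cast at this
      rw [add_assoc, this]
      exact fun he => hnb i h ((g⁻¹ ^ k).injective he)
    · have := hs1 (k + 1) 1 hnpos
      rw [show k * (n : ℤ) + i + 2 = (k + 1) * n + (1 : ℕ) by push_cast; rw [add_mul]; omega, this,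
        zpow_add_one, RelIso.mul_apply]
      intro he
      apply hjoin
      rw [show n - 1 = i by omega]
      exact (g⁻¹ ^ k).injective he
  · intro j
    simp only
    obtain ⟨k, i, hi, rfl⟩ := hdiv j
    rw [show k * (n : ℤ) + i - n = (k - 1) * n + i by ring, hs1 k i hi.le, hs1 _ i hi.le,
      ← RelIso.mul_apply]
    congr 1
    group

/-- If all automorphisms that agree with the hyperbolic `x` on a ball are hyperbolic, then the
ball contains an edge of the axis of `x`. -/
theorem dist_proj_lt_of_hyperbolic [X.LocallyFinite] {q : ℕ} (hX : X.IsTree)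
    (hreg : X.IsRegularOfDegree (q + 1)) (m : Line X) {x : Aut X} {n : ℤ}
    (hx : ∀ j, x (m.vert j) = m.vert (j - n)) (o : V) (R : ℕ)
    (hhyp : ∀ k : Aut X, (∀ u, X.dist o u ≤ R → k u = u) → x * k ∈ hyperbolicSet X) :
    m.depth o < R := by
  by_contra hR
  push Not at hR
  -- If the depth of `o` is at least `R`, the ball lies in one branch, which `k` fixes. But `x * k`
  -- reflects the axis, so it fixes a vertex or inverts an edge according to the parity of `n`.
  obtain ⟨k, hk1, hk2⟩ := exists_aut_reverse hX hreg m (m.proj o)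
  refine hhyp k (fun u hu => hk1 u ?_) ?_
  · by_contra hne
    have := m.dist_eq_of_proj_ne hX (Ne.symm hne)
    omega
  · have hxk : ∀ j, (x * k) (m.vert j) = m.vert (2 * m.proj o - n - j) := fun j => by
      rw [RelIso.mul_apply, hk2, hx]
      congr 1
      ring
    obtain ⟨c, hc | hc⟩ := Int.even_or_odd' (2 * m.proj o - n)
    · left
      refine ⟨m.vert c, ?_⟩
      rw [hxk, hc]
      congr 1
      ring
    · right
      refine ⟨s(m.vert c, m.vert (c + 1)), m.adj c, ?_⟩
      rw [Sym2.map_mk, hxk, hxk, hc, Sym2.eq_swap]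
      congr 2 <;> ring

end Hyperbolic

/-! ### The groups `S` and `M` in terms of fixed vertices of the line. -/

section Horospheres

variable {V : Type*} {X : SimpleGraph V}

theorem Line.exists_eq_vert_of_cusp_eq (l : Line X) {r : Ray X} (h : cusp r = l.infty) :
    ∃ a b : ℕ, ∀ j : ℕ, r.vert (a + j) = l.vert ((b : ℤ) + j) := by
  obtain ⟨a, b, hab⟩ := Quotient.exact h
  refine ⟨a, b, fun j => (hab j).trans ?_⟩
  simp

/-- The Busemann function of the positive end of the line decreases along rays to this end. -/
theorem Line.depth_sub_proj_ray (hX : X.IsTree) (l : Line X) {r : Ray X} {a b : ℕ}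
    (h : ∀ j : ℕ, r.vert (a + j) = l.vert ((b : ℤ) + j)) (N : ℕ) :
    (l.depth (r.vert N) : ℤ) - l.proj (r.vert N) = a - b - N := by
  have h1 := dist_geodesic hX (fun j => r.vert (N + j)) (fun j => r.adj (N + j))
    (fun j => r.noBacktrack (N + j)) (a + (l.proj (r.vert N)).natAbs)
  simp only [add_zero] at h1
  rw [show N + (a + (l.proj (r.vert N)).natAbs) = a + (N + (l.proj (r.vert N)).natAbs) by ring,
    h, l.dist_vert hX] at h1
  omega

theorem mem_parabolic_of_vert (l : Line X) {g : Aut X} (m n : ℕ)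
    (h : ∀ j : ℕ, g (l.vert (m + j)) = l.vert (n + j)) : g ∈ parabolic l.infty := by
  change g • l.infty = l.infty
  unfold Line.infty
  rw [smul_cusp]
  apply Quotient.sound
  refine ⟨m, n, fun j => ?_⟩
  simpa [Ray.map] using h j

/-- An element of `P` carries a far part of the ray to `∞` to a shift of it. The level `depth -
proj` is constant on horospheres, so preserving them forces the shift to vanish. -/
theorem mem_horoStab_iff (hX : X.IsTree) (l : Line X) (g : Aut X) :
    g ∈ horoStab l.infty ↔ ∃ J : ℤ, ∀ i, J ≤ i → g (l.vert i) = l.vert i := by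
  constructor
  · intro hg
    have h1 : g • l.infty = l.infty := hg.1
    unfold Line.infty at h1
    rw [smul_cusp] at h1
    obtain ⟨m, n, hmn⟩ := l.exists_eq_vert_of_cusp_eq h1
    simp only [Ray.map] at hmn
    let rs : Ray X :=
      { vert := fun j => l.vert ((m : ℤ) + j)
        adj := fun j => by simpa [add_assoc] using l.adj ((m : ℤ) + j)
        noBacktrack := fun j => by simpa [add_assoc] using l.noBacktrack ((m : ℤ) + j) }
    have hrs : cusp rs = l.infty := Quotient.sound ⟨0, m, fun j => by simp [rs]⟩
    have h2 : SameHorosphere l.infty (l.vert m) (l.vert m) :=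
      ⟨rs, rs, by simp [rs], by simp [rs], hrs, hrs, 0, rfl⟩
    have h3 := (hg.2 _ _).2 h2
    have hm0 := hmn 0
    simp only [add_zero, Nat.cast_zero] at hm0
    rw [hm0] at h3
    obtain ⟨r, s, hr0, hs0, hr, hs, N, hN⟩ := h3
    obtain ⟨a, b, hab⟩ := l.exists_eq_vert_of_cusp_eq hr
    obtain ⟨a', b', hab'⟩ := l.exists_eq_vert_of_cusp_eq hs
    have e1 := l.depth_sub_proj_ray hX hab 0
    have e2 := l.depth_sub_proj_ray hX hab' 0
    have e3 := l.depth_sub_proj_ray hX hab N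
    have e4 := l.depth_sub_proj_ray hX hab' N
    rw [hr0, l.depth_vert hX, l.proj_vert hX] at e1
    rw [hs0, l.depth_vert hX, l.proj_vert hX] at e2
    rw [hN] at e3
    have hmn' : m = n := by omega
    refine ⟨m, fun i hi => ?_⟩
    have := hmn (i - m).toNat
    rw [← hmn'] at this
    push_cast at this
    rwa [Int.toNat_of_nonneg (by omega), add_sub_cancel] at this
  -- One implication suffices: applied to `g⁻¹` it yields the other.
  · have key : ∀ (g : Aut X) (J : ℤ), (∀ i, J ≤ i → g (l.vert i) = l.vert i) →
        g ∈ parabolic l.infty ∧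
        ∀ x y, SameHorosphere l.infty x y → SameHorosphere l.infty x (g y) := by
      intro g J hJ
      have hp : g ∈ parabolic l.infty :=
        mem_parabolic_of_vert l J.toNat J.toNat fun j => hJ _ (by omega)
      refine ⟨hp, ?_⟩
      rintro x y ⟨r, s, hr0, hs0, hr, hs, N, hN⟩
      obtain ⟨a, b, hab⟩ := l.exists_eq_vert_of_cusp_eq hr
      obtain ⟨a', b', hab'⟩ := l.exists_eq_vert_of_cusp_eq hs
      have e3 := l.depth_sub_proj_ray hX hab N
      have e4 := l.depth_sub_proj_ray hX hab' N
      rw [hN] at e3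
      refine ⟨r, s.map g, hr0, congrArg g hs0, hr, ?_, a + (a' + J.natAbs), ?_⟩
      · rw [← smul_cusp, hs]
        exact hp
      · have h5 := hab (a' + J.natAbs)
        have h6 := hab' (a + J.natAbs)
        rw [show a' + (a + J.natAbs) = a + (a' + J.natAbs) by ring] at h6
        rw [h5]
        simp only [Ray.map]
        rw [h6, hJ _ (by omega)]
        congr 1
        omega
    rintro ⟨J, hJ⟩
    have hJ' : ∀ i, J ≤ i → g⁻¹ (l.vert i) = l.vert i := fun i hi => by
      conv_lhs => rw [← hJ i hi]
      rw [RelIso.inv_apply_self]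
    refine ⟨(key g J hJ).1, fun x y => ⟨fun h => ?_, (key g J hJ).2 x y⟩⟩
    have := (key g⁻¹ J hJ').2 _ _ h
    rwa [RelIso.inv_apply_self] at this

/-- An element of `M` preserves the line and fixes its far vertices; the distance to a sufficiently
far one determines the position on the line. -/
theorem mem_compactLevi_iff (hX : X.IsTree) (l : Line X) (g : Aut X) :
    g ∈ compactLevi l ↔ ∀ i, g (l.vert i) = l.vert i := by
  constructor
  · rintro ⟨hg1, hg2⟩ i
    obtain ⟨J, hJ⟩ := (mem_horoStab_iff hX l g).1 hg2
    obtain ⟨i', hi'⟩ := (hg1.2 (l.vert i)).2 ⟨i, rfl⟩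
    have h1 := l.dist_vert_vert hX i (i.natAbs + i'.natAbs + J.natAbs)
    rw [← dist_map hX g, hJ (i.natAbs + i'.natAbs + J.natAbs) (by omega), ← hi', l.dist_vert_vert hX] at h1
    rw [← hi']
    congr 1
    omega
  · intro h
    refine ⟨⟨mem_parabolic_of_vert l 0 0 fun j => h _, fun x => ?_⟩,
      (mem_horoStab_iff hX l g).2 ⟨0, fun i _ => h i⟩⟩
    constructor
    · rintro ⟨i, hi⟩
      exact ⟨i, g.injective (by rw [h, hi])⟩
    · rintro ⟨i, rfl⟩
      exact ⟨i, (h i).symm⟩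

end Horospheres

/-! ### The set `A⁻` and the character function. -/

section Torus

variable {V : Type*} {X : SimpleGraph V} {l : Line X}
  {σ : (levi l ⧸ (compactLevi l).subgroupOf (levi l)) →* levi l}

/-- Elements with the same translation length differ by an element of `M`, and a splitting picks one
element of each class. -/
theorem eq_of_mem_negTorus (hX : X.IsTree) (hσ : IsSplitting l σ) {a a' : parabolic l.infty}
    (ha : a ∈ negTorus l σ) (ha' : a' ∈ negTorus l σ) {n : ℤ}
    (h : ∀ j, (a : Aut X) (l.vert j) = l.vert (j - n))
    (h' : ∀ j, (a' : Aut X) (l.vert j) = l.vert (j - n)) : a = a' := by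
  obtain ⟨⟨c, ⟨d, rfl⟩, hc⟩, -⟩ := ha
  obtain ⟨⟨c', ⟨d', rfl⟩, hc'⟩, -⟩ := ha'
  simp only [Subgroup.subtype_apply] at hc hc'
  have : (QuotientGroup.mk (σ d) : levi l ⧸ (compactLevi l).subgroupOf (levi l)) =
      QuotientGroup.mk (σ d') := by
    rw [QuotientGroup.eq, Subgroup.mem_subgroupOf, mem_compactLevi_iff hX]
    intro i
    change ((σ d : Aut X)⁻¹ * (σ d' : Aut X)) (l.vert i) = _
    rw [hc, hc', RelIso.mul_apply, h', ← h, RelIso.inv_apply_self]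
  rw [hσ, hσ] at this
  apply Subtype.ext
  rw [← hc, ← hc', this]

/-- Transitivity on lines gives some translation in `L`; the splitting replaces it by an element of
`A` in the same class modulo `M`, which acts on the line in the same way. -/
theorem exists_mem_negTorus [X.LocallyFinite] {q : ℕ} (hX : X.IsTree)
    (hreg : X.IsRegularOfDegree (q + 1)) (hσ : IsSplitting l σ) {n : ℤ} (hn : 0 < n) :
    ∃ a ∈ negTorus l σ, ∀ j, (a : Aut X) (l.vert j) = l.vert (j - n) := by
  obtain ⟨t, ht⟩ := exists_aut_line hX hreg l
    { vert := fun j => l.vert (j - n)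
      adj := fun j => by
        have := l.adj (j - n)
        rwa [show j - n + 1 = j + 1 - n by ring] at this
      noBacktrack := fun j => by
        have := l.noBacktrack (j - n)
        rwa [show j - n + 2 = j + 2 - n by ring] at this }
  simp only at ht
  have htp : t ∈ parabolic l.infty := mem_parabolic_of_vert l n.toNat 0 fun j => by
    rw [ht]
    congr 1
    push_cast
    omega
  have htl : t ∈ levi l := by
    refine ⟨htp, fun x => ⟨?_, ?_⟩⟩
    · rintro ⟨i, hi⟩
      refine ⟨i + n, t.injective ?_⟩
      rw [ht, add_sub_cancel_right, hi]
    · rintro ⟨i, rfl⟩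
      exact ⟨i - n, (ht i).symm⟩
  obtain ⟨c, hc⟩ : ∃ c, c = (QuotientGroup.mk ⟨t, htl⟩ :
    levi l ⧸ (compactLevi l).subgroupOf (levi l)) := ⟨_, rfl⟩
  have h1 := (hσ c).trans hc
  rw [eq_comm, QuotientGroup.eq, Subgroup.mem_subgroupOf, mem_compactLevi_iff hX] at h1
  have h2 : ∀ j, (σ c : Aut X) (l.vert j) = l.vert (j - n) := by
    intro j
    have h3 : (t⁻¹ * (σ c : Aut X)) (l.vert j) = l.vert j := h1 j
    rw [RelIso.mul_apply] at h3
    rw [← ht, ← h3, RelIso.apply_inv_self, h3]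
  refine ⟨⟨σ c, (σ c).2.1⟩, ⟨⟨σ c, ⟨c, rfl⟩, rfl⟩, n, hn, h2⟩, h2⟩

/-- A hyperbolic automorphism is conjugate to an element of `A⁻`. -/
theorem exists_conj_mem_negTorus [X.LocallyFinite] {q : ℕ} (hX : X.IsTree)
    (hreg : X.IsRegularOfDegree (q + 1)) (hσ : IsSplitting l σ) {n : ℤ} (hn : 0 < n)
    (m : Line X) {g : Aut X} (hg : ∀ j, g (m.vert j) = m.vert (j - n)) :
    ∃ a ∈ negTorus l σ, (∀ j, (a : Aut X) (l.vert j) = l.vert (j - n)) ∧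
      ∃ h : Aut X, (∀ j, h (l.vert j) = m.vert j) ∧ h * a * h⁻¹ = g := by
  obtain ⟨a, ha, haj⟩ := exists_mem_negTorus (σ := σ) hX hreg hσ hn
  obtain ⟨z, hz⟩ := exists_aut_line hX hreg l m
  obtain ⟨h, hh, hc⟩ := exists_conj_of_translation hX hreg l hn haj (y := z⁻¹ * g * z) (by
    intro j
    rw [RelIso.mul_apply, RelIso.mul_apply, hz, hg, ← hz, RelIso.inv_apply_self])
  refine ⟨a, ha, haj, z * h, fun j => by rw [RelIso.mul_apply, hh, hz], ?_⟩
  rw [mul_inv_rev, show z * h * (a : Aut X) * (h⁻¹ * z⁻¹) = z * (h * a * h⁻¹) * z⁻¹ by group, hc]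
  group

variable {E : Type*} [AddCommGroup E] [Module ℂ E]

open Classical in
/-- The character function on the hyperbolic set. -/
noncomputable def hyperbolicCharacter (π : Representation ℂ (Aut X) E) (l : Line X)
    (σ : (levi l ⧸ (compactLevi l).subgroupOf (levi l)) →* levi l) (g : Aut X) : ℂ :=
  if H : ∃ a ∈ negTorus l σ, ∃ h : Aut X, h * a * h⁻¹ = g then
    LinearMap.trace ℂ (jacquetSpace π l.infty) (jacquet π l.infty H.choose)
  else 0

/-- Independence of the choice: conjugate elements of `A⁻` have the same translation length, hence
are equal. -/
theorem hyperbolicCharacter_eq (hX : X.IsTree) (hσ : IsSplitting l σ)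
    (π : Representation ℂ (Aut X) E) {a : parabolic l.infty} (ha : a ∈ negTorus l σ)
    {h g : Aut X} (hg : h * a * h⁻¹ = g) : hyperbolicCharacter π l σ g =
      LinearMap.trace ℂ (jacquetSpace π l.infty) (jacquet π l.infty a) := by
  have H : ∃ a ∈ negTorus l σ, ∃ h : Aut X, h * a * h⁻¹ = g := ⟨a, ha, h, hg⟩
  rw [hyperbolicCharacter, dif_pos H]
  obtain ⟨a', ha', ⟨h', hg'⟩, e⟩ : ∃ a', a' ∈ negTorus l σ ∧ (∃ h : Aut X, h * a' * h⁻¹ = g) ∧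
      H.choose = a' := ⟨_, H.choose_spec.1, H.choose_spec.2, rfl⟩
  rw [e]
  obtain ⟨-, n, hn, hj⟩ := id ha
  obtain ⟨-, n', hn', hj'⟩ := id ha'
  congr 2
  suffices n' = n by
    subst this
    exact eq_of_mem_negTorus hX hσ ha' ha hj' hj
  refine translation_length_unique hX l
    ⟨fun j => (h'⁻¹ * h) (l.vert j), fun j => (h'⁻¹ * h).map_adj_iff.2 (l.adj j),
      fun j e => l.noBacktrack j ((h'⁻¹ * h).injective e)⟩ hn' hn hj' fun j => ?_
  change (a' : Aut X) ((h'⁻¹ * h) (l.vert j)) = (h'⁻¹ * h) (l.vert (j - n))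
  rw [← hj, ← RelIso.mul_apply, ← RelIso.mul_apply]
  congr 1
  rw [← hg, mul_inv_eq_iff_eq_mul] at hg'
  have : (a' : Aut X) = h'⁻¹ * (h * a * h⁻¹ * h') := by rw [← hg']; group
  rw [this]
  group

theorem isHyperbolicCharacter_unique [X.LocallyFinite] {q : ℕ} (hX : X.IsTree)
    (hreg : X.IsRegularOfDegree (q + 1)) (hσ : IsSplitting l σ)
    (π : Representation ℂ (Aut X) E) :
    ∃! θ : Aut X → ℂ, IsHyperbolicCharacter π l σ θ := by
  refine ⟨hyperbolicCharacter π l σ, ⟨?_, ?_, ?_⟩, fun θ hθ => ?_⟩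
  · intro g hg
    rw [hyperbolicCharacter, dif_neg]
    rintro ⟨a, ⟨-, n, hn, hj⟩, h, rfl⟩
    apply hg
    refine mem_hyperbolicSet_of_translation hX
      ⟨fun j => h (l.vert j), fun j => h.map_adj_iff.2 (l.adj j),
        fun j e => l.noBacktrack j (h.injective e)⟩ hn fun j => ?_
    simp only
    rw [RelIso.mul_apply, RelIso.mul_apply, RelIso.inv_apply_self, hj]
  · intro g hg k
    obtain ⟨m, n, hn, hm⟩ := exists_axis hX hg
    obtain ⟨a, ha, -, h, -, hh⟩ := exists_conj_mem_negTorus hX hreg hσ hn m hm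
    rw [hyperbolicCharacter_eq hX hσ π ha hh, hyperbolicCharacter_eq hX hσ π ha (h := k * h)]
    rw [← hh]
    group
  · intro a ha
    exact hyperbolicCharacter_eq hX hσ π ha (h := 1) (by simp)
  · funext g
    by_cases hg : g ∈ hyperbolicSet X
    · obtain ⟨m, n, hn, hm⟩ := exists_axis hX hg
      obtain ⟨a, ha, haj, h, -, hh⟩ := exists_conj_mem_negTorus hX hreg hσ hn m hm
      rw [hyperbolicCharacter_eq hX hσ π ha hh, ← hh,
        hθ.conj _ (mem_hyperbolicSet_of_translation hX l hn haj), hθ.trace_eq a ha]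
    · rw [hθ.zero_off g hg, hyperbolicCharacter, dif_neg]
      rintro ⟨a, ⟨-, n, hn, hj⟩, h, rfl⟩
      apply hg
      refine mem_hyperbolicSet_of_translation hX
        ⟨fun j => h (l.vert j), fun j => h.map_adj_iff.2 (l.adj j),
          fun j e => l.noBacktrack j (h.injective e)⟩ hn fun j => ?_
      simp only
      rw [RelIso.mul_apply, RelIso.mul_apply, RelIso.inv_apply_self, hj]

end Torus
end TreeCharacter

namespace TreeCharacter

/-! ### Averaging without topology: finite orbits replace smoothness under a compact group. -/

section Averaging

open Representation

variable {K E : Type*} [Group K] [AddCommGroup E] [Module ℂ E]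

/-- Every vector is fixed by a subgroup of finite index. -/
def HasFiniteOrbits (ρ : Representation ℂ K E) : Prop :=
  ∀ v, ∃ H : Subgroup K, H.FiniteIndex ∧ ∀ h ∈ H, ρ h v = v

theorem rep_out_eq {ρ : Representation ℂ K E} {H : Subgroup K} {v : E}
    (hv : ∀ h ∈ H, ρ h v = v) (g : K) : ρ (QuotientGroup.mk g : K ⧸ H).out v = ρ g v := by
  obtain ⟨h, hh⟩ := QuotientGroup.mk_out_eq_mul H g
  rw [hh, map_mul, Module.End.mul_apply, hv h h.2]

/-- Summation over the cosets of a normal subgroup of finite index kills any given element of the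
kernel once the subgroup fixes the finitely many vectors involved, while it multiplies invariants by
the index. Averaging over an orbit splits a vector into the two parts. -/
theorem isCompl_invariants_ker {ρ : Representation ℂ K E} (hρ : HasFiniteOrbits ρ) :
    IsCompl (invariants ρ) (Coinvariants.ker ρ) := by
  classical
  constructor
  · rw [Submodule.disjoint_def]
    intro x hx hx'
    -- Vanishing for all smaller `N` makes the property stable under sums: the two subgroups are
    -- intersected.
    have key : ∃ H : Subgroup K, H.FiniteIndex ∧ ∀ N : Subgroup K, N ≤ H → N.Normal →
        ∀ _ : N.FiniteIndex, ∑ᶠ c : K ⧸ N, ρ c.out x = 0 := by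
      refine Submodule.span_induction (p := fun x _ => ∃ H : Subgroup K, H.FiniteIndex ∧
        ∀ N : Subgroup K, N ≤ H → N.Normal → ∀ _ : N.FiniteIndex, ∑ᶠ c : K ⧸ N, ρ c.out x = 0)
        ?_ ?_ ?_ ?_ hx'
      · rintro _ ⟨⟨k, w⟩, rfl⟩
        obtain ⟨H, hH, hw⟩ := hρ w
        refine ⟨H, hH, fun N hN hNn hNf => ?_⟩
        have := Fintype.ofFinite (K ⧸ N)
        rw [finsum_eq_sum_of_fintype]
        simp only [map_sub, Finset.sum_sub_distrib]
        rw [sub_eq_zero]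
        refine Fintype.sum_equiv (Equiv.mulRight (QuotientGroup.mk k : K ⧸ N)) _ _ fun c => ?_
        have h1 : c * (QuotientGroup.mk k : K ⧸ N) = QuotientGroup.mk (c.out * k) := by
          conv_lhs => rw [← QuotientGroup.out_eq' c]
          rfl
        change _ = ρ (c * (QuotientGroup.mk k : K ⧸ N)).out w
        rw [h1, rep_out_eq (fun h hh => hw h (hN hh)), map_mul,
          Module.End.mul_apply]
      · exact ⟨⊤, inferInstance, fun N _ _ _ => by simp⟩
      · rintro x y - - ⟨H, hH, hx⟩ ⟨H', hH', hy⟩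
        refine ⟨H ⊓ H', inferInstance, fun N hN hNn hNf => ?_⟩
        have := Fintype.ofFinite (K ⧸ N)
        have h1 := hx N (hN.trans inf_le_left) hNn hNf
        have h2 := hy N (hN.trans inf_le_right) hNn hNf
        rw [finsum_eq_sum_of_fintype] at h1 h2 ⊢
        simp only [map_add, Finset.sum_add_distrib, h1, h2, add_zero]
      · rintro a x - ⟨H, hH, hx⟩
        refine ⟨H, hH, fun N hN hNn hNf => ?_⟩
        have := Fintype.ofFinite (K ⧸ N)
        have h1 := hx N hN hNn hNf
        rw [finsum_eq_sum_of_fintype] at h1 ⊢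
        simp only [map_smul, ← Finset.smul_sum, h1, smul_zero]
    obtain ⟨H, hH, h⟩ := key
    have h1 := h H.normalCore H.normalCore_le inferInstance inferInstance
    have := Fintype.ofFinite (K ⧸ H.normalCore)
    rw [finsum_eq_sum_of_fintype, Finset.sum_congr rfl fun c _ => hx c.out, Finset.sum_const,
      Finset.card_univ, ← Nat.cast_smul_eq_nsmul ℂ, smul_eq_zero] at h1
    exact h1.resolve_left (Nat.cast_ne_zero.2 Fintype.card_ne_zero)
  · rw [codisjoint_iff, eq_top_iff]
    intro v _
    obtain ⟨H, hH, hv⟩ := hρ v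
    have := Fintype.ofFinite (K ⧸ H)
    have hc : (Fintype.card (K ⧸ H) : ℂ) ≠ 0 := Nat.cast_ne_zero.2 Fintype.card_ne_zero
    have h1 : ∑ c : K ⧸ H, ρ c.out v ∈ invariants ρ := by
      intro k
      rw [map_sum]
      refine Fintype.sum_equiv (MulAction.toPerm k) _ _ fun c => ?_
      have h2 : (MulAction.toPerm k : Equiv.Perm (K ⧸ H)) c = QuotientGroup.mk (k * c.out) := by
        conv_lhs => rw [← QuotientGroup.out_eq' c]
        rfl
      rw [h2, rep_out_eq hv, map_mul, Module.End.mul_apply]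
    have h2 : ∑ c : K ⧸ H, (ρ c.out v - v) ∈ Coinvariants.ker ρ :=
      Submodule.sum_mem _ fun c _ => Coinvariants.sub_mem_ker _ _
    have h3 : v = (Fintype.card (K ⧸ H) : ℂ)⁻¹ • ∑ c : K ⧸ H, ρ c.out v +
        (-(Fintype.card (K ⧸ H) : ℂ)⁻¹) • ∑ c : K ⧸ H, (ρ c.out v - v) := by
      rw [Finset.sum_sub_distrib, Finset.sum_const, Finset.card_univ, ← Nat.cast_smul_eq_nsmul ℂ,
        smul_sub, smul_smul, neg_mul, inv_mul_cancel₀ hc]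
      module
    rw [h3]
    exact Submodule.add_mem_sup (Submodule.smul_mem _ _ h1) (Submodule.smul_mem _ _ h2)

/-- A finite average of translates of an `N`-invariant functional computes it on averages. -/
theorem exists_sum_eq_of_functional {ρ : Representation ℂ K E} (η : E →ₗ[ℂ] ℂ)
    {N : Subgroup K} (hN : N.FiniteIndex) (hη : ∀ n ∈ N, ∀ v, η (ρ n v) = η v) :
    ∃ s : Finset K, ∃ a : ℂ, a * s.card = 1 ∧ (∀ v ∈ invariants ρ, a * ∑ k ∈ s, η (ρ k v) = η v) ∧
      ∀ v ∈ Coinvariants.ker ρ, a * ∑ k ∈ s, η (ρ k v) = 0 := by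
  classical
  have := Fintype.ofFinite (K ⧸ N.normalCore)
  have hc : (Fintype.card (K ⧸ N.normalCore) : ℂ) ≠ 0 := Nat.cast_ne_zero.2 Fintype.card_ne_zero
  have hs : ∀ v, ∑ k ∈ (Finset.univ : Finset (K ⧸ N.normalCore)).image
      (Quotient.out : K ⧸ N.normalCore → K), η (ρ k v) =
      ∑ c : K ⧸ N.normalCore, η (ρ c.out v) := fun v =>
    Finset.sum_image fun a _ b _ h => Quotient.out_injective h
  refine ⟨Finset.univ.image (Quotient.out : K ⧸ N.normalCore → K),
    (Fintype.card (K ⧸ N.normalCore) : ℂ)⁻¹, ?_, ?_, ?_⟩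
  · rw [Finset.card_image_of_injective _ Quotient.out_injective, Finset.card_univ]
    exact inv_mul_cancel₀ hc
  · intro v hv
    rw [hs, Finset.sum_congr rfl fun c _ => congrArg η (hv c.out), Finset.sum_const,
      Finset.card_univ, nsmul_eq_mul, inv_mul_cancel_left₀ hc]
  · intro v hv
    rw [hs, mul_eq_zero]
    right
    refine Submodule.span_induction (p := fun v _ => ∑ c : K ⧸ N.normalCore, η (ρ c.out v) = 0)
      ?_ (by simp) ?_ ?_ hv
    · rintro _ ⟨⟨k, w⟩, rfl⟩
      simp only [map_sub, Finset.sum_sub_distrib]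
      rw [sub_eq_zero]
      refine Fintype.sum_equiv (Equiv.mulRight (QuotientGroup.mk k : K ⧸ N.normalCore)) _ _
        fun c => ?_
      have h1 : c * (QuotientGroup.mk k : K ⧸ N.normalCore) = QuotientGroup.mk (c.out * k) := by
        conv_lhs => rw [← QuotientGroup.out_eq' c]
        rfl
      obtain ⟨⟨n, hn⟩, h2⟩ := QuotientGroup.mk_out_eq_mul N.normalCore (c.out * k)
      -- Here the functional, not the vector, is invariant, so `n` has to be moved to the left by
      -- normality of the core.
      have h3 : (c.out * k) * n * (c.out * k)⁻¹ ∈ N :=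
        N.normalCore_le ((inferInstance : N.normalCore.Normal).conj_mem n hn _)
      change _ = η (ρ (c * (QuotientGroup.mk k : K ⧸ N.normalCore)).out w)
      rw [h1, h2]
      simp only
      rw [show c.out * k * n = (c.out * k * n * (c.out * k)⁻¹) * (c.out * k) by group,
        map_mul, Module.End.mul_apply, hη _ h3, map_mul, Module.End.mul_apply]
    · intro x y _ _ hx hy
      simp only [map_add, Finset.sum_add_distrib, hx, hy, add_zero]
    · intro a x _ hx
      simp only [map_smul, ← Finset.smul_sum, hx, smul_zero]

end Averaging

/-! ### The idempotents `e_K` and their relations. -/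

section Subgroups

open Representation

variable {G E : Type*} [Group G] [AddCommGroup E] [Module ℂ E] (π : Representation ℂ G E)

/-- The vectors fixed by the subgroup `K`. -/
noncomputable abbrev fixedVectors (K : Subgroup G) : Submodule ℂ E := invariants (π.comp K.subtype)

/-- The span of the vectors `π k v - v` for `k` in `K`. -/
abbrev augVectors (K : Subgroup G) : Submodule ℂ E := Coinvariants.ker (π.comp K.subtype)

open Classical in
/-- The projection to the vectors fixed by `K`. -/
noncomputable def average (K : Subgroup G) : E →ₗ[ℂ] E :=
  if h : IsCompl (fixedVectors π K) (augVectors π K) then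
    (fixedVectors π K).projection (augVectors π K) h else 0

variable {π}

theorem mem_fixedVectors {K : Subgroup G} {v : E} :
    v ∈ fixedVectors π K ↔ ∀ k ∈ K, π k v = v := by
  simp [mem_invariants]

theorem sub_mem_augVectors {K : Subgroup G} {k : G} (hk : k ∈ K) (v : E) :
    π k v - v ∈ augVectors π K :=
  Coinvariants.sub_mem_ker (ρ := π.comp K.subtype) ⟨k, hk⟩ v

theorem augVectors_induction {K : Subgroup G} {p : Submodule ℂ E}
    (h : ∀ k ∈ K, ∀ v, π k v - v ∈ p) : augVectors π K ≤ p := by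
  refine Submodule.span_le.2 ?_
  rintro _ ⟨⟨k, w⟩, rfl⟩
  exact h k k.2 w

theorem augVectors_mono {K H : Subgroup G} (h : H ≤ K) : augVectors π H ≤ augVectors π K :=
  augVectors_induction fun _ hk v => sub_mem_augVectors (h hk) v

theorem fixedVectors_anti {K H : Subgroup G} (h : H ≤ K) :
    fixedVectors π K ≤ fixedVectors π H := fun _ hv =>
  mem_fixedVectors.2 fun k hk => mem_fixedVectors.1 hv k (h hk)

/-- This permits averaging over fixators of half-trees and rays, which need not be open. -/
theorem HasFiniteOrbits.mono {K H : Subgroup G} (hK : HasFiniteOrbits (π.comp K.subtype))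
    (h : H ≤ K) : HasFiniteOrbits (π.comp H.subtype) := by
  intro v
  obtain ⟨N, hN, hv⟩ := hK v
  refine ⟨N.comap (Subgroup.inclusion h), ⟨?_⟩, fun k hk => ?_⟩
  · rw [Subgroup.index_comap]
    exact (inferInstance : (N.subgroupOf (Subgroup.inclusion h).range).FiniteIndex).index_ne_zero
  · exact hv _ hk

theorem average_mem {K : Subgroup G} (hK : HasFiniteOrbits (π.comp K.subtype))
    (v : E) : average π K v ∈ fixedVectors π K := by
  rw [average, dif_pos (isCompl_invariants_ker hK)]
  exact Submodule.projection_apply_mem _ _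

theorem sub_average_mem {K : Subgroup G} (hK : HasFiniteOrbits (π.comp K.subtype))
    (v : E) : v - average π K v ∈ augVectors π K := by
  rw [average, dif_pos (isCompl_invariants_ker hK)]
  exact Submodule.sub_projection_mem _ _

/-- Uniqueness of the decomposition reduces identities between averages to these two memberships. -/
theorem average_eq {K : Subgroup G} (hK : HasFiniteOrbits (π.comp K.subtype))
    {v w : E} (hw : w ∈ fixedVectors π K) (hv : v - w ∈ augVectors π K) :
    average π K v = w := by
  rw [← sub_eq_zero]
  refine Submodule.disjoint_def.1 (isCompl_invariants_ker hK).disjoint _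
    (Submodule.sub_mem _ (average_mem hK v) hw) ?_
  have := Submodule.sub_mem _ hv (sub_average_mem hK v)
  rwa [sub_sub_sub_cancel_left] at this

theorem average_of_mem {K : Subgroup G} (hK : HasFiniteOrbits (π.comp K.subtype))
    {v : E} (hv : v ∈ fixedVectors π K) : average π K v = v :=
  average_eq hK hv (by simp)

theorem average_of_mem_aug {K : Subgroup G} (hK : HasFiniteOrbits (π.comp K.subtype))
    {v : E} (hv : v ∈ augVectors π K) : average π K v = 0 :=
  average_eq hK (Submodule.zero_mem _) (by simpa)

theorem average_rep {K : Subgroup G} (hK : HasFiniteOrbits (π.comp K.subtype))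
    {k : G} (hk : k ∈ K) (v : E) : average π K (π k v) = average π K v := by
  rw [← sub_eq_zero, ← map_sub]
  exact average_of_mem_aug hK (sub_mem_augVectors hk v)

theorem average_conj {K : Subgroup G} (hK : HasFiniteOrbits (π.comp K.subtype))
    {K' : Subgroup G} (hK' : HasFiniteOrbits (π.comp K'.subtype)) {g : G}
    (h : ∀ k, k ∈ K ↔ g * k * g⁻¹ ∈ K') (v : E) :
    π g (average π K v) = average π K' (π g v) := by
  symm
  apply average_eq hK'
  · rw [mem_fixedVectors]
    intro k hk
    have h1 : g⁻¹ * k * g ∈ K := by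
      rw [h]
      convert hk using 1
      group
    rw [← Module.End.mul_apply, ← map_mul, show k * g = g * (g⁻¹ * k * g) by group, map_mul,
      Module.End.mul_apply, mem_fixedVectors.1 (average_mem hK v) _ h1]
  · rw [← map_sub]
    have : augVectors π K ≤ (augVectors π K').comap (π g) := by
      refine augVectors_induction fun k hk w => ?_
      rw [Submodule.mem_comap, map_sub]
      have := sub_mem_augVectors (π := π) ((h k).1 hk) (π g w)
      rwa [← Module.End.mul_apply, ← map_mul, inv_mul_cancel_right, map_mul,
        Module.End.mul_apply] at this
    exact this (sub_average_mem hK v)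

/-- The average over a group that is generated by two commuting subgroups. -/
theorem average_average_of_commute {K : Subgroup G} (hK : HasFiniteOrbits (π.comp K.subtype))
    {A B : Subgroup G} (hA : A ≤ K) (hB : B ≤ K)
    (hgen : ∀ k ∈ K, ∃ a ∈ A, ∃ b ∈ B, k = a * b) (hcomm : ∀ a ∈ A, ∀ b ∈ B, a * b = b * a)
    (v : E) : average π A (average π B v) = average π K v := by
  symm
  apply average_eq hK
  · rw [mem_fixedVectors]
    intro k hk
    obtain ⟨a, ha, b, hb, rfl⟩ := hgen k hk
    have hbA : ∀ k, k ∈ A ↔ b * k * b⁻¹ ∈ A := by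
      intro k
      constructor
      · intro hk
        rwa [← hcomm k hk b hb, mul_inv_cancel_right]
      · intro hk
        have := hcomm _ hk b hb
        rw [inv_mul_cancel_right, mul_assoc, mul_left_cancel_iff] at this
        rwa [mul_assoc, ← this] at hk
    rw [map_mul, Module.End.mul_apply, average_conj (hK.mono hA) (hK.mono hA) hbA,
      mem_fixedVectors.1 (average_mem (hK.mono hB) v) b hb,
      mem_fixedVectors.1 (average_mem (hK.mono hA) _) a ha]
  · have h1 := augVectors_mono hB (sub_average_mem (hK.mono hB) v)
    have h2 := augVectors_mono hA (sub_average_mem (hK.mono hA) (average π B v))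
    have := Submodule.add_mem _ h1 h2
    rwa [sub_add_sub_cancel] at this

end Subgroups
end TreeCharacter

namespace TreeCharacter

/-! ### Fixators as compact open subgroups. -/

section Topology

variable {V : Type*} {X : SimpleGraph V}

/-- The pointwise stabilizer of a set of vertices. -/
def fixator (X : SimpleGraph V) (F : Set V) : Subgroup (Aut X) where
  carrier := {g | ∀ u ∈ F, g u = u}
  one_mem' := fun _ _ => rfl
  mul_mem' := fun {g h} hg hh u hu => by rw [RelIso.mul_apply, hh u hu, hg u hu]
  inv_mem' := fun {g} hg u hu => by
    conv_lhs => rw [← hg u hu]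
    rw [RelIso.inv_apply_self]

theorem mem_fixator {F : Set V} {g : Aut X} : g ∈ fixator X F ↔ ∀ u ∈ F, g u = u := Iff.rfl

theorem fixator_anti {F F' : Set V} (h : F ⊆ F') : fixator X F' ≤ fixator X F :=
  fun _ hg u hu => hg u (h hu)

theorem continuous_aut_iff {Y : Type*} [TopologicalSpace Y] {f : Y → Aut X} :
    Continuous f ↔ ∀ v w, IsOpen {y | f y v = w} := by
  let _ : TopologicalSpace V := ⊥
  have : DiscreteTopology V := ⟨rfl⟩
  rw [continuous_induced_rng, continuous_pi_iff]
  exact forall_congr' fun v => continuous_discrete_rng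

theorem isOpen_setOf_apply_eq (v w : V) : IsOpen {g : Aut X | g v = w} :=
  continuous_aut_iff.1 continuous_id v w

instance : ContinuousMul (Aut X) where
  continuous_mul := by
    rw [continuous_aut_iff]
    intro v w
    have : {y : Aut X × Aut X | (y.1 * y.2) v = w} =
        ⋃ u, {g : Aut X | g u = w} ×ˢ {h : Aut X | h v = u} := by
      ext ⟨g, h⟩
      simp [RelIso.mul_apply]
    rw [this]
    exact isOpen_iUnion fun u => (isOpen_setOf_apply_eq u w).prod (isOpen_setOf_apply_eq v u)

theorem isOpen_fixator {F : Set V} (hF : F.Finite) : IsOpen (fixator X F : Set (Aut X)) := by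
  have : (fixator X F : Set (Aut X)) = ⋂ u ∈ F, {g : Aut X | g u = u} := by
    ext g
    simp [mem_fixator]
  rw [this]
  exact hF.isOpen_biInter fun u _ => isOpen_setOf_apply_eq u u

theorem exists_fixator_le {U : Subgroup (Aut X)} (hU : IsOpen (U : Set (Aut X))) :
    ∃ F : Set V, F.Finite ∧ fixator X F ≤ U := by
  let _ : TopologicalSpace V := ⊥
  have : DiscreteTopology V := ⟨rfl⟩
  obtain ⟨O, hO, hOU⟩ := isOpen_induced_iff.1 hU
  have h1 : (fun v : V => (1 : Aut X) v) ∈ O := by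
    have : (1 : Aut X) ∈ (fun (g : Aut X) (v : V) => g v) ⁻¹' O := by
      rw [hOU]
      exact U.one_mem
    exact this
  obtain ⟨I, u, hu, hI⟩ := isOpen_pi_iff.1 hO _ h1
  refine ⟨I, I.finite_toSet, fun g hg => ?_⟩
  have : g ∈ (fun (g : Aut X) (v : V) => g v) ⁻¹' O := by
    refine hI fun v hv => ?_
    simp only
    rw [hg v hv]
    exact (hu v hv).2
  rw [hOU] at this
  exact this

variable {E : Type*} [AddCommGroup E] [Module ℂ E] {π : Representation ℂ (Aut X) E}

theorem IsAdmissible.exists_fixator (hπ : IsAdmissible π) (v : E) :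
    ∃ F : Set V, F.Finite ∧ v ∈ fixedVectors π (fixator X F) := by
  obtain ⟨U, hU, -, hv⟩ := hπ.smooth v
  obtain ⟨F, hF, hFU⟩ := exists_fixator_le hU
  exact ⟨F, hF, mem_fixedVectors.2 fun k hk => hv k (hFU hk)⟩

variable [X.LocallyFinite] {q : ℕ}

theorem finite_ball (hX : X.IsTree) (o : V) (n : ℕ) : {w | X.dist o w ≤ n}.Finite := by
  induction n with
  | zero =>
    refine (Set.finite_singleton o).subset fun w hw => ?_
    exact ((hX.connected o w).dist_eq_zero_iff.1 (Nat.le_zero.1 hw)).symm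
  | succ n ih =>
    refine (ih.union (ih.biUnion fun v _ => (X.neighborSet v).toFinite)).subset fun w hw => ?_
    rcases Nat.lt_or_ge (X.dist o w) (n + 1) with h | h
    · exact Or.inl (Nat.lt_succ_iff.1 h)
    · obtain ⟨v, hv, hd⟩ := exists_adj_dist_succ hX (x := o) (v := w) (by
        rintro rfl
        simp at h)
      refine Or.inr (Set.mem_biUnion (x := v) ?_ hv.symm)
      change X.dist o w ≤ n + 1 at hw
      change X.dist o v ≤ n
      omega

/-- A fixed vertex embeds the fixator in a product of finite balls. The image is closed, because
adjacency and local injectivity, conditions on two coordinates at a time, already characterize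
automorphisms. -/
theorem isCompact_fixator (hX : X.IsTree) (hreg : X.IsRegularOfDegree (q + 1)) {F : Set V}
    (hF : F.Nonempty) : IsCompact (fixator X F : Set (Aut X)) := by
  let _ : TopologicalSpace V := ⊥
  have : DiscreteTopology V := ⟨rfl⟩
  obtain ⟨o, ho⟩ := hF
  have hind : Topology.IsInducing (fun (g : Aut X) (v : V) => g v) := ⟨rfl⟩
  rw [hind.isCompact_iff]
  have hpi : IsCompact (Set.univ.pi fun v : V => {w | X.dist o w ≤ X.dist o v}) :=
    isCompact_univ_pi fun v => (finite_ball hX o _).isCompact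
  have himg : (fun (g : Aut X) (v : V) => g v) '' (fixator X F) =
      {φ | ∀ u ∈ F, φ u = u} ∩ {φ | ∀ u v, X.Adj u v → X.Adj (φ u) (φ v)} ∩
      {φ | ∀ u v w, X.Adj w u → X.Adj w v → φ u = φ v → u = v} := by
    ext φ
    constructor
    · rintro ⟨g, hg, rfl⟩
      exact ⟨⟨hg, fun u v h => g.map_adj_iff.2 h⟩, fun u v w _ _ h => g.injective h⟩
    · rintro ⟨⟨h1, h2⟩, h3⟩
      obtain ⟨g, hg⟩ := exists_aut_of_injOn_neighborSet hX hreg φ h2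
        fun w u hu v hv h => h3 u v w hu hv h
      exact ⟨g, fun u hu => by rw [hg, h1 u hu], funext hg⟩
  refine hpi.of_isClosed_subset ?_ ?_
  · have hcl : ∀ (u v : V) (p : V → V → Prop), IsClosed {φ : V → V | p (φ u) (φ v)} := by
      intro u v p
      have h1 : Continuous fun φ : V → V => (φ u, φ v) :=
        (continuous_apply u).prodMk (continuous_apply v)
      exact (isClosed_discrete {x : V × V | p x.1 x.2}).preimage h1
    rw [himg]
    refine (IsClosed.inter ?_ ?_).inter ?_
    · simp only [Set.ofPred_forall]
      exact isClosed_iInter fun u => isClosed_iInter fun _ => hcl u u fun a _ => a = u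
    · simp only [Set.ofPred_forall]
      exact isClosed_iInter fun u => isClosed_iInter fun v => isClosed_iInter fun _ =>
        hcl u v fun a b => X.Adj a b
    · simp only [Set.ofPred_forall]
      exact isClosed_iInter fun u => isClosed_iInter fun v => isClosed_iInter fun _ =>
        isClosed_iInter fun _ => isClosed_iInter fun _ => hcl u v fun a b => a = b → u = v
  · rintro _ ⟨g, hg, rfl⟩ v -
    change X.dist o (g v) ≤ X.dist o v
    conv_lhs => rw [← hg o ho, dist_map hX]

/-- As `K` fixes `o`, vertex orbits stay in finite balls around `o`; finitely many stabilizers of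
finite index are intersected. -/
theorem fixator_finiteIndex (hX : X.IsTree) (o : V) {K : Subgroup (Aut X)}
    (hK : K ≤ fixator X {o}) {F : Set V} (hF : F.Finite) :
    ((fixator X F).subgroupOf K).FiniteIndex := by
  have h1 : ∀ u, ((fixator X {u}).subgroupOf K).FiniteIndex := by
    intro u
    have h2 : (fixator X {u}).subgroupOf K = MulAction.stabilizer K u := by
      ext g
      simp only [Subgroup.mem_subgroupOf, mem_fixator, Set.mem_singleton_iff, forall_eq,
        MulAction.mem_stabilizer_iff]
      rfl
    rw [h2]
    constructor
    rw [MulAction.index_stabilizer]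
    have h3 : (MulAction.orbit K u).Finite := by
      refine (finite_ball hX o (X.dist o u)).subset ?_
      rintro _ ⟨g, rfl⟩
      change X.dist o ((g : Aut X) u) ≤ X.dist o u
      conv_lhs => rw [← hK g.2 o rfl, dist_map hX]
    exact (Set.ncard_pos h3).2 (MulAction.nonempty_orbit u) |>.ne'
  have h2 : ⨅ u ∈ hF.toFinset, (fixator X {u}).subgroupOf K ≤ (fixator X F).subgroupOf K := by
    intro g hg u hu
    simp only [Subgroup.mem_iInf] at hg
    exact hg u (hF.mem_toFinset.2 hu) u rfl
  have := Subgroup.finiteIndex_iInf' (s := hF.toFinset) (fun u => (fixator X {u}).subgroupOf K)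
    fun u _ => h1 u
  exact Subgroup.finiteIndex_of_le h2

theorem IsAdmissible.hasFiniteOrbits (hπ : IsAdmissible π) (hX : X.IsTree) (o : V)
    {K : Subgroup (Aut X)} (hK : K ≤ fixator X {o}) :
    HasFiniteOrbits (π.comp K.subtype) := by
  intro v
  obtain ⟨F, hF, hv⟩ := hπ.exists_fixator v
  exact ⟨_, fixator_finiteIndex hX o hK hF, fun h hh => mem_fixedVectors.1 hv _ hh⟩

theorem IsAdmissible.finiteDimensional_fixator (hπ : IsAdmissible π) (hX : X.IsTree)
    (hreg : X.IsRegularOfDegree (q + 1)) {F : Set V} (hF : F.Finite) (hF' : F.Nonempty) :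
    FiniteDimensional ℂ (fixedVectors π (fixator X F)) :=
  hπ.finite _ (isOpen_fixator hF) (isCompact_fixator hX hreg hF')

end Topology
end TreeCharacter

namespace TreeCharacter

/-! ### Comparing traces along a quotient map. -/

section LinearAlgebra

variable {k W J : Type*} [Field k] [AddCommGroup W] [Module k W] [AddCommGroup J] [Module k J]
  [FiniteDimensional k W]

/-- On the finite-dimensional, `A`-stable range of `p` the injective `A` is bijective, so membership
of `(A ^ m) x` in the range descends to `x`. -/
theorem surjective_of_forall_exists_pow_mem {p : W →ₗ[k] J} {T : W →ₗ[k] W} {A : J →ₗ[k] J}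
    (hpT : ∀ w, p (T w) = A (p w)) (hA : Function.Injective A)
    (h : ∀ x, ∃ m : ℕ, (A ^ m) x ∈ LinearMap.range p) : Function.Surjective p := by
  have hr : ∀ x ∈ LinearMap.range p, A x ∈ LinearMap.range p := by
    rintro _ ⟨w, rfl⟩
    exact ⟨T w, hpT w⟩
  have hs : Function.Surjective (A.restrict hr) :=
    LinearMap.injective_iff_surjective.1 fun x y hxy =>
      Subtype.ext (hA (congrArg Subtype.val hxy))
  have key : ∀ (m : ℕ) (x : J), (A ^ m) x ∈ LinearMap.range p → x ∈ LinearMap.range p := by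
    intro m
    induction m with
    | zero => exact fun x hx => hx
    | succ m ih =>
      intro x hx
      rw [pow_succ', Module.End.mul_apply] at hx
      obtain ⟨⟨y, hy⟩, hy'⟩ := hs ⟨_, hx⟩
      have : A y = A ((A ^ m) x) := congrArg Subtype.val hy'
      exact ih x (hA this ▸ hy)
  intro x
  obtain ⟨m, hm⟩ := h x
  exact key m x hm

/-- For a section `s` of `p`, write `T = T s p + T (1 - s p)`. The first term has the trace of `p T
s = A`; the second maps into the kernel of `p` and acts there as `T`, so it is nilpotent. -/
theorem trace_eq_of_surjective {p : W →ₗ[k] J} {T : W →ₗ[k] W} {A : J →ₗ[k] J}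
    (hpT : ∀ w, p (T w) = A (p w)) (hp : Function.Surjective p)
    (hnil : ∀ w, p w = 0 → ∃ m : ℕ, (T ^ m) w = 0) :
    LinearMap.trace k W T = LinearMap.trace k J A := by
  have : FiniteDimensional k J := Module.Finite.of_surjective p hp
  obtain ⟨s, hs⟩ := p.exists_rightInverse_of_surjective (LinearMap.range_eq_top.2 hp)
  have hs' : ∀ x, p (s x) = x := fun x => LinearMap.congr_fun hs x
  have h1 : T = T ∘ₗ s ∘ₗ p + T ∘ₗ (LinearMap.id - s ∘ₗ p) := by
    ext w
    simp
  have h2 : IsNilpotent (T ∘ₗ (LinearMap.id - s ∘ₗ p)) := by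
    rw [Module.End.isNilpotent_iff_of_finite]
    intro w
    have h3 : p (w - s (p w)) = 0 := by rw [map_sub, hs', sub_self]
    have h4 : ∀ m : ℕ, ((T ∘ₗ (LinearMap.id - s ∘ₗ p)) ^ (m + 1)) w = (T ^ (m + 1)) (w - s (p w)) ∧
        p ((T ^ (m + 1)) (w - s (p w))) = 0 := by
      intro m
      induction m with
      | zero => simp [hpT, hs']
      | succ m ih =>
        rw [pow_succ', Module.End.mul_apply, ih.1, pow_succ' T (m + 1), Module.End.mul_apply, hpT, ih.2,
          map_zero]
        simp only [LinearMap.comp_apply, LinearMap.sub_apply, LinearMap.id_apply, ih.2, map_zero,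
          sub_zero, and_true]
    obtain ⟨m, hm⟩ := hnil _ h3
    refine ⟨m + 1, ?_⟩
    rw [(h4 m).1, pow_succ', Module.End.mul_apply, hm, map_zero]
  rw [h1, map_add, (LinearMap.isNilpotent_trace_of_isNilpotent h2).eq_zero, add_zero,
    ← LinearMap.comp_assoc, LinearMap.trace_comp_comm']
  congr 1
  ext x
  simp [hpT, hs']

end LinearAlgebra

/-! ### The operators `e_K π(g)` on `π^K`. -/

section LocalTrace

variable {G E : Type*} [Group G] [AddCommGroup E] [Module ℂ E] (π : Representation ℂ G E)

open Classical in
/-- The average over `K` as a map to the fixed vectors. -/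
noncomputable def averageOnto (K : Subgroup G) : E →ₗ[ℂ] fixedVectors π K :=
  if h : ∀ v, average π K v ∈ fixedVectors π K then (average π K).codRestrict _ h else 0

/-- The operator `e_K π(g)` on the vectors fixed by `K`. -/
noncomputable def localOperator (K : Subgroup G) (g : G) :
    fixedVectors π K →ₗ[ℂ] fixedVectors π K :=
  averageOnto π K ∘ₗ π g ∘ₗ (fixedVectors π K).subtype

variable {π}

theorem coe_averageOnto {K : Subgroup G} (hK : HasFiniteOrbits (π.comp K.subtype)) (v : E) :
    (averageOnto π K v : E) = average π K v := by
  rw [averageOnto, dif_pos (average_mem hK)]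
  rfl

theorem coe_localOperator {K : Subgroup G} (hK : HasFiniteOrbits (π.comp K.subtype)) (g : G)
    (v : fixedVectors π K) : (localOperator π K g v : E) = average π K (π g v) :=
  coe_averageOnto hK _

/-- `π h` identifies the vectors fixed by `K' = h⁻¹ K h` with those fixed by `K` and intertwines the
two operators. -/
theorem trace_localOperator_conj {K K' : Subgroup G} (hK : HasFiniteOrbits (π.comp K.subtype))
    (hK' : HasFiniteOrbits (π.comp K'.subtype)) {h : G} (hh : ∀ k, k ∈ K' ↔ h * k * h⁻¹ ∈ K)
    [FiniteDimensional ℂ (fixedVectors π K)] [FiniteDimensional ℂ (fixedVectors π K')] (a : G) :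
    LinearMap.trace ℂ _ (localOperator π K (h * a * h⁻¹)) =
      LinearMap.trace ℂ _ (localOperator π K' a) := by
  have hh' : ∀ k, k ∈ K ↔ h⁻¹ * k * h⁻¹⁻¹ ∈ K' := by
    intro k
    rw [hh]
    group
  obtain ⟨α, hα⟩ : ∃ α, α = averageOnto π K ∘ₗ π h ∘ₗ (fixedVectors π K').subtype := ⟨_, rfl⟩
  obtain ⟨β, hβ⟩ : ∃ β, β = averageOnto π K' ∘ₗ π h⁻¹ ∘ₗ (fixedVectors π K).subtype := ⟨_, rfl⟩
  have hα' : ∀ w, (α w : E) = π h w := by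
    intro w
    rw [hα]
    change (averageOnto π K (π h w) : E) = _
    rw [coe_averageOnto hK, ← average_conj hK' hK hh, average_of_mem hK' w.2]
  have hβ' : ∀ w, (β w : E) = π h⁻¹ w := by
    intro w
    rw [hβ]
    change (averageOnto π K' (π h⁻¹ w) : E) = _
    rw [coe_averageOnto hK', ← average_conj hK hK' hh', average_of_mem hK w.2]
  have h1 : α ∘ₗ β = LinearMap.id := by
    ext w
    change (α (β w) : E) = w
    rw [hα', hβ', ← Module.End.mul_apply, ← map_mul, mul_inv_cancel, map_one, Module.End.one_apply]
  have h2 : localOperator π K' a = β ∘ₗ localOperator π K (h * a * h⁻¹) ∘ₗ α := by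
    ext w
    change (localOperator π K' a w : E) = β (localOperator π K (h * a * h⁻¹) (α w))
    rw [hβ', coe_localOperator hK, coe_localOperator hK', hα', average_conj hK hK' hh']
    have : a = h⁻¹ * (h * a * h⁻¹) * h := by group
    conv_lhs => rw [this, map_mul, map_mul, Module.End.mul_apply, Module.End.mul_apply]
  rw [h2, LinearMap.trace_comp_comm', LinearMap.comp_assoc, h1, LinearMap.comp_id]

/-- Only an inclusion is required, because `a` contracts the half-tree groups rather than
normalizing them. -/
theorem map_augVectors_le {K K' : Subgroup G} {g : G} (h : ∀ k ∈ K, g * k * g⁻¹ ∈ K') {v : E}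
    (hv : v ∈ augVectors π K) : π g v ∈ augVectors π K' := by
  have : augVectors π K ≤ (augVectors π K').comap (π g) := by
    refine augVectors_induction fun k hk w => ?_
    rw [Submodule.mem_comap, map_sub]
    have := sub_mem_augVectors (π := π) (h k hk) (π g w)
    rwa [← Module.End.mul_apply, ← map_mul, inv_mul_cancel_right, map_mul,
      Module.End.mul_apply] at this
  exact this hv

theorem map_mem_fixedVectors {K K' : Subgroup G} {g : G} (h : ∀ k ∈ K', g⁻¹ * k * g ∈ K) {v : E}
    (hv : v ∈ fixedVectors π K) : π g v ∈ fixedVectors π K' := by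
  rw [mem_fixedVectors] at hv ⊢
  intro k hk
  rw [← Module.End.mul_apply, ← map_mul, show k * g = g * (g⁻¹ * k * g) by group, map_mul,
    Module.End.mul_apply, hv _ (h k hk)]

end LocalTrace

/-! ### Factorization of a fixator along an edge, and contraction by translations. -/

section HalfTrees

variable {V : Type*} {X : SimpleGraph V}

theorem commute_of_mem_fixator {A : Set V} {g h : Aut X} (hg : g ∈ fixator X A)
    (hh : h ∈ fixator X Aᶜ) : g * h = h * g := by
  have key : ∀ {A : Set V} {g h : Aut X}, g ∈ fixator X A → h ∈ fixator X Aᶜ →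
      ∀ u ∉ A, g (h u) = h (g u) := by
    intro A g h hg hh u hu
    have : g u ∉ A := fun hA => hu (by rwa [g.injective (hg _ hA)] at hA)
    rw [hh u hu, hh _ this]
  ext u
  rw [RelIso.mul_apply, RelIso.mul_apply]
  by_cases hu : u ∈ A
  · exact (key hh (by rwa [compl_compl]) u (by simpa)).symm
  · exact key hg hh u hu

/-- The fixator of a set that contains an edge of the line is the product of the subgroups that
act on one side of this edge only. -/
theorem exists_mul_of_mem_fixator [X.LocallyFinite] {q : ℕ} (hX : X.IsTree)
    (hreg : X.IsRegularOfDegree (q + 1)) (l : Line X) {F : Set V} {c : ℤ}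
    (h1 : l.vert (c - 1) ∈ F) (h2 : l.vert c ∈ F) {g : Aut X} (hg : g ∈ fixator X F) :
    ∃ a ∈ fixator X (F ∪ {u | c ≤ l.proj u}), ∃ b ∈ fixator X (F ∪ {u | l.proj u < c}),
      g = a * b := by
  classical
  have hcase : ∀ j : ℤ, (if j < c then g else 1) = (if j + 1 < c then g else 1) ∨ j = c - 1 := by
    intro j
    by_cases hj : j < c
    · by_cases hj' : j + 1 < c
      · simp [hj, hj']
      · right
        omega
    · left
      rw [if_neg hj, if_neg (by omega)]
  -- The glued family changes only across the edge from `c - 1` to `c`, both ends of which `g`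
  -- fixes.
  obtain ⟨a, ha⟩ := exists_aut_glue hX hreg l (fun j => if j < c then g else 1)
    (fun j => by
      rcases hcase j with h | rfl
      · rw [h]
      · simp [hg _ h1])
    (fun j => by
      rcases hcase j with h | rfl
      · rw [h]
      · simp [hg _ h2])
  have ha1 : ∀ u, l.proj u < c → a u = g u := fun u hu => by rw [ha, if_pos hu]
  have ha2 : ∀ u, c ≤ l.proj u → a u = u := fun u hu => by rw [ha, if_neg (by omega)]; rfl
  have ha3 : a ∈ fixator X F := by
    intro u hu
    rcases lt_or_ge (l.proj u) c with h | h
    · rw [ha1 u h, hg u hu]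
    · exact ha2 u h
  refine ⟨a, ?_, a⁻¹ * g, ?_, by group⟩
  · rintro u (hu | hu)
    · exact ha3 u hu
    · exact ha2 u hu
  · rintro u (hu | hu)
    · exact mul_mem (inv_mem ha3) hg u hu
    · rw [RelIso.mul_apply, ← ha1 u hu, RelIso.inv_apply_self]

/-- This plays the role of the Iwahori factorization. The set `F` may be infinite: the lemma serves
for a ball and for a ray. -/
theorem average_average_halfTrees [X.LocallyFinite] {q : ℕ} (hX : X.IsTree)
    (hreg : X.IsRegularOfDegree (q + 1)) (l : Line X) {F : Set V} {c : ℤ}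
    (h1 : l.vert (c - 1) ∈ F) (h2 : l.vert c ∈ F) {E : Type*} [AddCommGroup E] [Module ℂ E]
    {π : Representation ℂ (Aut X) E} (hπ : IsAdmissible π) (v : E) :
    average π (fixator X (F ∪ {u | c ≤ l.proj u}))
      (average π (fixator X (F ∪ {u | l.proj u < c})) v) = average π (fixator X F) v := by
  refine average_average_of_commute (hπ.hasFiniteOrbits hX _
    (fixator_anti (Set.singleton_subset_iff.2 h2))) (fixator_anti Set.subset_union_left)
    (fixator_anti Set.subset_union_left)
    (fun g hg => exists_mul_of_mem_fixator hX hreg l h1 h2 hg) (fun a ha b hb => ?_) v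
  refine commute_of_mem_fixator (A := {u | c ≤ l.proj u})
    (fixator_anti Set.subset_union_right ha) (fixator_anti ?_ hb)
  intro u hu
  exact Or.inr (not_le.1 (show ¬c ≤ l.proj u from hu))

variable {l : Line X} {a : Aut X} {n : ℤ} {o : V} {R : ℕ}

theorem proj_inv_translation (hX : X.IsTree) (ha : ∀ j, a (l.vert j) = l.vert (j - n)) (u : V) :
    l.proj (a⁻¹ u) = l.proj u + n ∧ l.depth (a⁻¹ u) = l.depth u := by
  have := l.proj_translation hX ha (a⁻¹ u)
  rw [RelIso.apply_inv_self] at this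
  omega

/-- `a⁻¹` moves towards `∞`: a ball vertex outside the half-tree either enters it or comes nearer to
`o`. So `a⁻¹` maps the fixed set into itself. -/
theorem conj_mem_fixator_left (hX : X.IsTree) (hn : 0 < n)
    (ha : ∀ j, a (l.vert j) = l.vert (j - n)) {k : Aut X}
    (hk : k ∈ fixator X ({u | X.dist o u ≤ R} ∪ {u | l.proj o ≤ l.proj u})) :
    a * k * a⁻¹ ∈ fixator X ({u | X.dist o u ≤ R} ∪ {u | l.proj o ≤ l.proj u}) := by
  intro u hu
  rw [RelIso.mul_apply, RelIso.mul_apply, hk, RelIso.apply_inv_self]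
  have h1 := proj_inv_translation hX ha u
  by_cases h2 : l.proj o ≤ l.proj (a⁻¹ u)
  · exact Or.inr h2
  · left
    have h3 : l.proj o ≠ l.proj (a⁻¹ u) := by omega
    have h4 : l.proj o ≠ l.proj u := by omega
    rcases hu with hu | hu
    · have h5 : X.dist o u ≤ R := hu
      rw [l.dist_eq_of_proj_ne hX h4] at h5
      change X.dist o (a⁻¹ u) ≤ R
      rw [l.dist_eq_of_proj_ne hX h3]
      omega
    · have h5 : l.proj o ≤ l.proj u := hu
      omega

theorem conj_mem_fixator_right (hX : X.IsTree) (hn : 0 < n)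
    (ha : ∀ j, a (l.vert j) = l.vert (j - n)) {k : Aut X}
    (hk : k ∈ fixator X ({u | X.dist o u ≤ R} ∪ {u | l.proj u < l.proj o})) :
    a⁻¹ * k * a ∈ fixator X ({u | X.dist o u ≤ R} ∪ {u | l.proj u < l.proj o}) := by
  intro u hu
  rw [RelIso.mul_apply, RelIso.mul_apply, hk, RelIso.inv_apply_self]
  have h1 := l.proj_translation hX ha u
  by_cases h2 : l.proj (a u) < l.proj o
  · exact Or.inr h2
  · left
    have h4 : l.proj o ≠ l.proj u := by omega
    rcases hu with hu | hu
    · have h5 : X.dist o u ≤ R := hu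
      rw [l.dist_eq_of_proj_ne hX h4] at h5
      change X.dist o (a u) ≤ R
      have h6 := dist_triangle' hX o (l.vert (l.proj o)) (a u)
      rw [SimpleGraph.dist_comm (u := l.vert (l.proj o)), l.dist_vert hX, l.dist_vert hX] at h6
      omega
    · have h5 : l.proj u < l.proj o := hu
      omega

end HalfTrees
end TreeCharacter

namespace TreeCharacter

/-! ### Jacquet's argument: the local trace equals the trace on `π_S`. -/

section Jacquet

open Representation

variable {V E : Type*} [AddCommGroup E] [Module ℂ E] {X : SimpleGraph V} {l : Line X}
  {π : Representation ℂ (Aut X) E}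

/-- `S` is the increasing union of the fixators of the rays from `l.vert J` to `∞`, and a vanishing
class involves only finitely many elements of `S`. -/
theorem exists_mem_augVectors_of_mk_eq_zero (hX : X.IsTree) {v : E}
    (hv : (Coinvariants.mk _ v : jacquetSpace π l.infty) = 0) :
    ∃ J : ℤ, v ∈ augVectors π (fixator X (l.vert '' Set.Ici J)) := by
  rw [Coinvariants.mk_eq_zero] at hv
  have hmono : ∀ {J J' : ℤ}, J ≤ J' → augVectors π (fixator X (l.vert '' Set.Ici J)) ≤
      augVectors π (fixator X (l.vert '' Set.Ici J')) := fun h =>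
    augVectors_mono (fixator_anti (Set.image_mono (Set.Ici_subset_Ici.2 h)))
  refine Submodule.span_induction
    (p := fun v _ => ∃ J : ℤ, v ∈ augVectors π (fixator X (l.vert '' Set.Ici J))) ?_ ?_ ?_ ?_ hv
  · rintro _ ⟨⟨⟨k, hk⟩, w⟩, rfl⟩
    obtain ⟨J, hJ⟩ := (mem_horoStab_iff hX l k).1 hk
    refine ⟨J, sub_mem_augVectors (π := π) (K := fixator X (l.vert '' Set.Ici J)) (k := k) ?_ w⟩
    rintro _ ⟨i, hi, rfl⟩
    exact hJ i hi
  · exact ⟨0, Submodule.zero_mem _⟩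
  · rintro x y - - ⟨J, hx⟩ ⟨J', hy⟩
    exact ⟨max J J', Submodule.add_mem _ (hmono (le_max_left _ _) hx)
      (hmono (le_max_right _ _) hy)⟩
  · rintro c x - ⟨J, hx⟩
    exact ⟨J, Submodule.smul_mem _ _ hx⟩

theorem mk_eq_zero_of_mem_augVectors {K : Subgroup (Aut X)} (hK : K ≤ horoStab l.infty) {v : E}
    (hv : v ∈ augVectors π K) : (Coinvariants.mk _ v : jacquetSpace π l.infty) = 0 := by
  rw [Coinvariants.mk_eq_zero]
  refine (augVectors_induction (p := Coinvariants.ker ((π.comp (parabolic l.infty).subtype).comp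
    ((horoStab l.infty).subgroupOf (parabolic l.infty)).subtype)) ?_) hv
  intro k hk w
  exact Coinvariants.sub_mem_ker
    (ρ := (π.comp (parabolic l.infty).subtype).comp
      ((horoStab l.infty).subgroupOf (parabolic l.infty)).subtype) ⟨⟨k, (hK hk).1⟩, hK hk⟩ w

variable [X.LocallyFinite] {q : ℕ}

/-- The trace of `e_K π(a)` for the fixator `K` of a ball that contains an edge of the axis of `a`
is the trace of `a` on the Jacquet module. -/
theorem trace_localOperator_ball (hX : X.IsTree) (hreg : X.IsRegularOfDegree (q + 1))
    (hπ : IsAdmissible π) {a : parabolic l.infty} {n : ℤ} (hn : 0 < n)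
    (ha : ∀ j, (a : Aut X) (l.vert j) = l.vert (j - n)) {o : V} {R : ℕ} (hR : l.depth o < R) :
    FiniteDimensional ℂ (jacquetSpace π l.infty) ∧
    LinearMap.trace ℂ _ (localOperator π (fixator X {u | X.dist o u ≤ R}) (a : Aut X)) =
      LinearMap.trace ℂ (jacquetSpace π l.infty) (jacquet π l.infty a) := by
  have hBfin : {u | X.dist o u ≤ R}.Finite := finite_ball hX o R
  have hBo : o ∈ {u | X.dist o u ≤ R} := by simp
  have hB1 : l.vert (l.proj o - 1) ∈ {u | X.dist o u ≤ R} := by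
    change X.dist o _ ≤ R
    rw [l.dist_vert hX]
    omega
  have hB2 : l.vert (l.proj o) ∈ {u | X.dist o u ≤ R} := by
    change X.dist o _ ≤ R
    rw [l.dist_vert hX]
    omega
  have hconjl : ∀ k, _ → _ := fun k => conj_mem_fixator_left (R := R) (o := o) (k := k) hX hn ha
  have hconjr : ∀ k, _ → _ := fun k => conj_mem_fixator_right (R := R) (o := o) (k := k) hX hn ha
  have hsplit : ∀ v, _ = _ := average_average_halfTrees hX hreg l hB1 hB2 hπ
  have hpowa : ∀ (m : ℕ) (u : V), l.proj (((a : Aut X) ^ m) u) = l.proj u - m * n := fun m u =>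
    (l.proj_translation hX (l.pow_translation ha m) u).1
  have hpowa' : ∀ (m : ℕ) (u : V), l.proj (((a : Aut X) ^ m)⁻¹ u) = l.proj u + m * n := fun m u =>
    (proj_inv_translation hX (l.pow_translation ha m) u).1
  have hbound : ∀ {F : Set V}, F.Finite → ∃ D : ℕ, ∀ u ∈ F, (l.proj u).natAbs ≤ D := by
    intro F hF
    obtain ⟨D, hD⟩ := (hF.image fun u => (l.proj u).natAbs).bddAbove
    exact ⟨D, fun u hu => hD ⟨u, hu, rfl⟩⟩
  have hmn : ∀ m : ℕ, (m : ℤ) ≤ m * n := fun m => le_mul_of_one_le_right (by positivity) hn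
  obtain ⟨B, hB⟩ : ∃ B, B = {u | X.dist o u ≤ R} := ⟨_, rfl⟩
  rw [← hB] at hBfin hBo hB1 hB2 hconjl hconjr hsplit ⊢
  obtain ⟨K, hK⟩ : ∃ K, K = fixator X B := ⟨_, rfl⟩
  obtain ⟨Kl, hKl⟩ : ∃ Kl, Kl = fixator X (B ∪ {u | l.proj o ≤ l.proj u}) := ⟨_, rfl⟩
  obtain ⟨Kr, hKr⟩ : ∃ Kr, Kr = fixator X (B ∪ {u | l.proj u < l.proj o}) := ⟨_, rfl⟩
  rw [← hKl] at hconjl hsplit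
  rw [← hKr] at hconjr hsplit
  rw [← hK] at hsplit ⊢
  have hKlK : Kl ≤ K := by
    rw [hKl, hK]
    exact fixator_anti Set.subset_union_left
  have hKrK : Kr ≤ K := by
    rw [hKr, hK]
    exact fixator_anti Set.subset_union_left
  have hKf : HasFiniteOrbits (π.comp K.subtype) :=
    hπ.hasFiniteOrbits hX o (hK ▸ fixator_anti (Set.singleton_subset_iff.2 hBo))
  have hKlf := hKf.mono hKlK
  have hKrf := hKf.mono hKrK
  have hKlS : Kl ≤ horoStab l.infty := by
    intro k hk
    rw [hKl] at hk
    refine (mem_horoStab_iff hX l k).2 ⟨l.proj o, fun i hi => hk _ (Or.inr ?_)⟩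
    change _ ≤ l.proj (l.vert i)
    rwa [l.proj_vert hX]
  have : FiniteDimensional ℂ (fixedVectors π K) :=
    hK ▸ hπ.finiteDimensional_fixator hX hreg hBfin ⟨o, hBo⟩
  -- `π a w` is still fixed by `Kr`, since `a⁻¹ Kr a ≤ Kr`; only the average over `Kl` remains.
  have hT : ∀ w : fixedVectors π K,
      (localOperator π K (a : Aut X) w : E) = average π Kl (π a w) := by
    intro w
    rw [coe_localOperator hKf, ← hsplit]
    congr 1
    exact average_of_mem hKrf (map_mem_fixedVectors hconjr (fixedVectors_anti hKrK w.2))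
  -- Since `a Kl a⁻¹ ≤ Kl`, an average over `Kl` before `π a` is absorbed by the one after it.
  have hTpow : ∀ (m : ℕ) (w : fixedVectors π K),
      ((localOperator π K (a : Aut X) ^ m) w : E) = average π Kl (π ((a : Aut X) ^ m) w) := by
    intro m w
    induction m with
    | zero =>
      rw [pow_zero, pow_zero, map_one]
      exact (average_of_mem hKlf (fixedVectors_anti hKlK w.2)).symm
    | succ m ih =>
      rw [pow_succ', Module.End.mul_apply, hT, ih, pow_succ' (a : Aut X), map_mul,
        Module.End.mul_apply]
      have h1 := average_of_mem_aug hKlf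
        (map_augVectors_le hconjl (sub_average_mem hKlf (π ((a : Aut X) ^ m) w)))
      rw [map_sub, map_sub, sub_eq_zero] at h1
      exact h1.symm
  obtain ⟨p, hp⟩ : ∃ p : E →ₗ[ℂ] jacquetSpace π l.infty, p = Coinvariants.mk _ := ⟨_, rfl⟩
  have hpa : ∀ v, p (π a v) = jacquet π l.infty a (p v) := fun v => by
    rw [hp]
    rfl
  have hpl : ∀ v, p (average π Kl v) = p v := by
    intro v
    have := mk_eq_zero_of_mem_augVectors hKlS (sub_average_mem hKlf v)
    rw [← hp, map_sub, sub_eq_zero] at this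
    exact this.symm
  have hpT : ∀ w, (p ∘ₗ (fixedVectors π K).subtype) (localOperator π K (a : Aut X) w) =
      jacquet π l.infty a ((p ∘ₗ (fixedVectors π K).subtype) w) := by
    intro w
    change p (localOperator π K (a : Aut X) w : E) = jacquet π l.infty a (p w)
    rw [hT, hpl, hpa]
  have hsurj : Function.Surjective (p ∘ₗ (fixedVectors π K).subtype) := by
    refine surjective_of_forall_exists_pow_mem hpT ?_ ?_
    · intro x y hxy
      have : ∀ x, jacquet π l.infty a⁻¹ (jacquet π l.infty a x) = x := by
        intro x
        rw [← Module.End.mul_apply, ← map_mul, inv_mul_cancel, map_one, Module.End.one_apply]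
      rw [← this x, hxy, this]
    · intro x
      obtain ⟨v, rfl⟩ : ∃ v, p v = x := hp ▸ Coinvariants.mk_surjective _ x
      obtain ⟨F, hF, hvF⟩ := hπ.exists_fixator v
      obtain ⟨D, hD⟩ := hbound hF
      -- For this `m` the power `a ^ m` pushes `F` into the half-tree fixed by `Kr`. Averaging over
      -- `Kl` then gives a `K`-fixed vector with the same image in `π_S`.
      obtain ⟨m, hm⟩ : ∃ m : ℕ, D < l.proj o + m := ⟨D + 1 + (l.proj o).natAbs, by omega⟩
      have h1 : π ((a : Aut X) ^ m) v ∈ fixedVectors π Kr := by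
        refine map_mem_fixedVectors (fun k hk u hu => ?_) hvF
        rw [hKr] at hk
        rw [RelIso.mul_apply, RelIso.mul_apply, hk, RelIso.inv_apply_self]
        right
        change l.proj _ < _
        rw [hpowa]
        have := hD u hu
        have := hmn m
        omega
      have h2 : average π Kl (π ((a : Aut X) ^ m) v) ∈ fixedVectors π K := by
        rw [← average_of_mem hKrf h1, hsplit]
        exact average_mem hKf _
      refine ⟨m, ⟨_, h2⟩, ?_⟩
      change p (average π Kl _) = _
      rw [hpl]
      clear h1 h2 hm
      induction m with
      | zero => simp
      | succ m ih =>
        rw [pow_succ', map_mul, Module.End.mul_apply, hpa, ih, pow_succ', Module.End.mul_apply]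
  refine ⟨Module.Finite.of_surjective _ hsurj, trace_eq_of_surjective hpT hsurj ?_⟩
  intro w hw
  have hw' : (Coinvariants.mk _ (w : E) : jacquetSpace π l.infty) = 0 := by
    rw [← hp]
    exact hw
  obtain ⟨J, hJ⟩ := exists_mem_augVectors_of_mk_eq_zero hX hw'
  obtain ⟨D, hD⟩ := hbound hBfin
  -- The cut lies on the ray and beyond the ball. So `S₂` fixes the ball, hence `w`, and the
  -- vanishing average over `S` is already the average over `S₁`.
  obtain ⟨c, hc⟩ : ∃ c : ℤ, c = J.natAbs + D + 1 := ⟨_, rfl⟩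
  obtain ⟨S, hS⟩ : ∃ S, S = fixator X (l.vert '' Set.Ici J) := ⟨_, rfl⟩
  obtain ⟨S₁, hS₁⟩ : ∃ S₁, S₁ = fixator X (l.vert '' Set.Ici J ∪ {u | c ≤ l.proj u}) := ⟨_, rfl⟩
  obtain ⟨S₂, hS₂⟩ : ∃ S₂, S₂ = fixator X (l.vert '' Set.Ici J ∪ {u | l.proj u < c}) := ⟨_, rfl⟩
  have hSsplit := average_average_halfTrees hX hreg l (F := l.vert '' Set.Ici J) (c := c)
    ⟨c - 1, by change J ≤ c - 1; omega, rfl⟩ ⟨c, by change J ≤ c; omega, rfl⟩ hπ (w : E)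
  rw [← hS, ← hS₁, ← hS₂] at hSsplit
  rw [← hS] at hJ
  have hSf : HasFiniteOrbits (π.comp S.subtype) := by
    rw [hS]
    exact hπ.hasFiniteOrbits hX (l.vert J)
      (fixator_anti (Set.singleton_subset_iff.2 ⟨J, Set.mem_Ici.2 le_rfl, rfl⟩))
  have hS₁f : HasFiniteOrbits (π.comp S₁.subtype) :=
    hSf.mono (by rw [hS, hS₁]; exact fixator_anti Set.subset_union_left)
  have hS₂f : HasFiniteOrbits (π.comp S₂.subtype) :=
    hSf.mono (by rw [hS, hS₂]; exact fixator_anti Set.subset_union_left)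
  have hS₂K : S₂ ≤ K := by
    rw [hS₂, hK]
    refine fixator_anti fun u hu => Or.inr ?_
    have := hD u hu
    change l.proj u < c
    omega
  rw [average_of_mem hS₂f (fixedVectors_anti hS₂K w.2), average_of_mem_aug hSf hJ] at hSsplit
  have h1 := sub_average_mem hS₁f (w : E)
  rw [hSsplit, sub_zero] at h1
  -- Now `a ^ m` conjugates `S₁` into `Kl`, because its inverse carries the ball and the half-tree
  -- of `Kl` beyond `c`.
  obtain ⟨m, hm⟩ : ∃ m : ℕ, c + D + (l.proj o).natAbs ≤ m :=
    ⟨c.natAbs + D + (l.proj o).natAbs, by omega⟩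
  refine ⟨m, Subtype.ext ?_⟩
  rw [hTpow]
  refine average_of_mem_aug hKlf (map_augVectors_le (fun k hk => ?_) h1)
  rw [hS₁] at hk
  rw [hKl]
  intro u hu
  rw [RelIso.mul_apply, RelIso.mul_apply, hk, RelIso.apply_inv_self]
  right
  change c ≤ l.proj _
  rw [hpowa']
  have h2 := hmn m
  rcases hu with hu | hu
  · have := hD u hu
    omega
  · have : l.proj o ≤ l.proj u := hu
    omega

end Jacquet
end TreeCharacter

namespace TreeCharacter

/-! ### Hecke operators and their traces. -/

section FiniteRank

variable {E : Type*} [AddCommGroup E] [Module ℂ E]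

/-- Cyclicity of the trace allows the range to be replaced by any finite-dimensional space
containing it. -/
theorem finiteRankTrace_eq {T : E →ₗ[ℂ] E} {W : Submodule ℂ E} [FiniteDimensional ℂ W]
    (hT : ∀ v, T v ∈ W) : FiniteDimensional ℂ (LinearMap.range T) ∧
      finiteRankTrace T = LinearMap.trace ℂ W (T.restrict (p := W) (q := W) fun x _ => hT x) := by
  have hle : LinearMap.range T ≤ W := by
    rintro _ ⟨v, rfl⟩
    exact hT v
  have hfin : FiniteDimensional ℂ (LinearMap.range T) := Submodule.finiteDimensional_of_le hle
  refine ⟨hfin, ?_⟩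
  have h1 : T.restrict (p := W) (q := W) (fun x _ => hT x) =
      Submodule.inclusion hle ∘ₗ (T.rangeRestrict ∘ₗ W.subtype) := rfl
  rw [h1, LinearMap.trace_comp_comm']
  rfl

end FiniteRank

section Hecke

open Representation

variable {V E : Type*} [AddCommGroup E] [Module ℂ E] {X : SimpleGraph V}
  {π : Representation ℂ (Aut X) E}

theorem continuous_of_right_invariant {G : Type*} [Group G] [TopologicalSpace G] [ContinuousMul G]
    {U : Subgroup G} (hU : IsOpen (U : Set G)) {F : G → ℂ} (hF : ∀ x, ∀ u ∈ U, F (x * u) = F x) :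
    Continuous F := by
  refine continuous_iff_continuousAt.2 fun x => ?_
  have h1 : {y | x⁻¹ * y ∈ U} ∈ nhds x :=
    (hU.preimage (continuous_const_mul x⁻¹)).mem_nhds (by simp [U.one_mem])
  refine (continuousAt_const (y := F x)).congr ?_
  filter_upwards [h1] with y hy
  rw [← hF x _ hy, mul_inv_cancel_left]

theorem IsAdmissible.heckeConverges (hπ : IsAdmissible π) {μ : Measure (Aut X)}
    [μ.IsHaarMeasure] {f : Aut X → ℂ} (hf : IsHeckeFunction μ f) (hc : HasCompactSupport f) :
    HeckeConverges π μ f := by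
  intro v η _
  obtain ⟨K, hK, -, hKf⟩ := hf.biinvariant
  obtain ⟨U, hU, -, hUv⟩ := hπ.smooth v
  refine Continuous.integrable_of_hasCompactSupport ?_ hc.mul_right
  refine continuous_of_right_invariant (U := K ⊓ U) (hK.inter hU) fun x u hu => ?_
  have h1 := hKf 1 K.one_mem u hu.1 x
  rw [one_mul] at h1
  rw [h1, map_mul, Module.End.mul_apply, hUv u hu.2]

variable [X.LocallyFinite] {q : ℕ}

theorem isSmoothVector_dual (hX : X.IsTree) (hreg : X.IsRegularOfDegree (q + 1)) {F : Set V}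
    (hF : F.Finite) (hF' : F.Nonempty) {η : Module.Dual ℂ E}
    (hη : ∀ k ∈ fixator X F, ∀ v, η (π k v) = η v) : IsSmoothVector π.dual η := by
  refine ⟨_, isOpen_fixator hF, isCompact_fixator hX hreg hF', fun k hk => ?_⟩
  ext v
  exact hη k⁻¹ (inv_mem hk) v

/-- Smooth functionals separate the points of an admissible representation. -/
theorem IsAdmissible.eq_of_forall_smooth (hπ : IsAdmissible π) (hX : X.IsTree)
    (hreg : X.IsRegularOfDegree (q + 1)) {v w : E}
    (h : ∀ η : Module.Dual ℂ E, IsSmoothVector π.dual η → η v = η w) : v = w := by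
  obtain ⟨o⟩ := hX.connected.nonempty
  obtain ⟨F, hF, hv⟩ := hπ.exists_fixator (v - w)
  have hfo := hπ.hasFiniteOrbits hX o (K := fixator X (insert o F))
    (fixator_anti (Set.singleton_subset_iff.2 (Set.mem_insert o F)))
  rw [← sub_eq_zero, ← Module.forall_dual_apply_eq_zero_iff ℂ]
  intro φ
  -- Averaging makes `φ` smooth without changing its value on the fixed vector `v - w`.
  have h1 := h (φ ∘ₗ average π (fixator X (insert o F)))
    (isSmoothVector_dual hX hreg (hF.insert o) (Set.insert_nonempty o F) fun k hk v => by
      rw [LinearMap.comp_apply, LinearMap.comp_apply, average_rep hfo hk])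
  rw [← sub_eq_zero, ← map_sub, LinearMap.comp_apply, average_of_mem hfo
    (fixedVectors_anti (fixator_anti (Set.subset_insert o F)) hv)] at h1
  exact h1

/-- The functional `v ↦ ∫ f(x) η(π(x)v) dx`. -/
noncomputable def heckeFunctional (π : Representation ℂ (Aut X) E) (μ : Measure (Aut X))
    (f : Aut X → ℂ) (η : Module.Dual ℂ E) (h : ∀ v, Integrable (fun x => f x * η (π x v)) μ) :
    E →ₗ[ℂ] ℂ where
  toFun v := ∫ x, f x * η (π x v) ∂μ
  map_add' v w := by
    simp only [map_add, mul_add]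
    exact integral_add (h v) (h w)
  map_smul' c v := by
    simp only [map_smul, smul_eq_mul, RingHom.id_apply]
    rw [← integral_const_mul]
    congr 1
    ext x
    ring

/-- A smooth `η` sees the average over `K` as a finite average of translates, all with the same
integral by left invariance of `f` and `μ`. -/
theorem integral_average (hX : X.IsTree) (hπ : IsAdmissible π) {μ : Measure (Aut X)}
    [μ.IsHaarMeasure] {f : Aut X → ℂ} {K : Subgroup (Aut X)} {o : V} (hK : K ≤ fixator X {o})
    (hf : ∀ k ∈ K, ∀ x, f (k * x) = f x) (hconv : HeckeConverges π μ f) {η : Module.Dual ℂ E}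
    (hη : IsSmoothVector π.dual η) (v : E) :
    ∫ x, f x * η (average π K (π x v)) ∂μ = ∫ x, f x * η (π x v) ∂μ := by
  have hfo := hπ.hasFiniteOrbits hX o hK
  obtain ⟨U, hU, -, hUη⟩ := id hη
  obtain ⟨F, hF, hFU⟩ := exists_fixator_le hU
  obtain ⟨s, c, hc, h1, h2⟩ := exists_sum_eq_of_functional (ρ := π.comp K.subtype) η
    (fixator_finiteIndex hX o hK hF) (fun n hn v => by
      have := LinearMap.congr_fun (hUη _ (inv_mem (hFU hn))) v
      rw [Representation.dual_apply, inv_inv] at this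
      exact this)
  have h3 : ∀ w, η (average π K w) = c * ∑ k ∈ s, η (π k w) := by
    intro w
    have e1 := h1 _ (average_mem hfo w)
    have e2 := h2 _ (sub_average_mem hfo w)
    rw [← e1, ← sub_eq_zero, ← neg_sub, neg_eq_zero, ← e2]
    simp only [map_sub, Finset.sum_sub_distrib, mul_sub]
    rfl
  have h4 : ∀ k : K, ∀ x, f x * η (π k (π x v)) = f (k * x) * η (π (k * x) v) := by
    intro k x
    rw [hf k k.2, map_mul, Module.End.mul_apply]
  have h5 : ∀ k : K, Integrable (fun x => f x * η (π k (π x v))) μ := by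
    intro k
    simp only [h4]
    exact (hconv v η hη).comp_mul_left (k : Aut X)
  have h6 : ∀ k : K, ∫ x, f x * η (π k (π x v)) ∂μ = ∫ x, f x * η (π x v) ∂μ := by
    intro k
    simp only [h4]
    exact integral_mul_left_eq_self (fun x => f x * η (π x v)) (k : Aut X)
  have h7 : ∀ x, f x * η (average π K (π x v)) = c * ∑ k ∈ s, f x * η (π k (π x v)) := by
    intro x
    rw [h3, ← Finset.mul_sum]
    ring
  simp only [h7]
  rw [integral_const_mul, integral_finsetSum _ fun k _ => h5 k]
  simp only [h6]
  rw [Finset.sum_const, nsmul_eq_mul, ← mul_assoc, hc, one_mul]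

/-- The trace of a Hecke operator as an integral of local traces. -/
theorem exists_heckeOperator (hX : X.IsTree) (hreg : X.IsRegularOfDegree (q + 1))
    (hπ : IsAdmissible π) {μ : Measure (Aut X)} [μ.IsHaarMeasure] {f : Aut X → ℂ} {F : Set V}
    (hF : F.Finite) (hF' : F.Nonempty) (hf : ∀ k ∈ fixator X F, ∀ x, f (k * x) = f x)
    (hconv : HeckeConverges π μ f) :
    Integrable (fun x => f x * LinearMap.trace ℂ _ (localOperator π (fixator X F) x)) μ ∧
      ∃ T : E →ₗ[ℂ] E, (∀ T', IsHeckeOperator π μ f T' ↔ T' = T) ∧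
        FiniteDimensional ℂ (LinearMap.range T) ∧
        finiteRankTrace T =
          ∫ x, f x * LinearMap.trace ℂ _ (localOperator π (fixator X F) x) ∂μ := by
  obtain ⟨o, ho⟩ := id hF'
  obtain ⟨K, hK⟩ : ∃ K, K = fixator X F := ⟨_, rfl⟩
  have hKo : K ≤ fixator X {o} := hK ▸ fixator_anti (Set.singleton_subset_iff.2 ho)
  have hfo := hπ.hasFiniteOrbits hX o hKo
  have hfin : FiniteDimensional ℂ (fixedVectors π K) :=
    hK ▸ hπ.finiteDimensional_fixator hX hreg hF hF'
  rw [← hK] at hf ⊢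
  let b := Module.finBasis ℂ (fixedVectors π K)
  let η : Fin (Module.finrank ℂ (fixedVectors π K)) → Module.Dual ℂ E := fun i =>
    b.coord i ∘ₗ averageOnto π K
  have hη : ∀ i, IsSmoothVector π.dual (η i) := by
    intro i
    refine isSmoothVector_dual hX hreg hF hF' fun k hk v => ?_
    rw [← hK] at hk
    have : averageOnto π K (π k v) = averageOnto π K v :=
      Subtype.ext (by rw [coe_averageOnto hfo, coe_averageOnto hfo, average_rep hfo hk])
    change b.coord i (averageOnto π K (π k v)) = _
    rw [this]
    rfl
  have hint : ∀ i v, Integrable (fun x => f x * η i (π x v)) μ := fun i v => hconv v _ (hη i)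
  -- The local trace is a finite sum of smooth matrix coefficients, so weak convergence makes it
  -- integrable against `f`.
  have htr : ∀ x, f x * LinearMap.trace ℂ _ (localOperator π K x) =
      ∑ i, f x * η i (π x (b i : E)) := by
    intro x
    rw [LinearMap.trace_eq_matrix_trace ℂ b, Matrix.trace, Finset.mul_sum]
    refine Finset.sum_congr rfl fun i _ => ?_
    rw [Matrix.diag_apply, LinearMap.toMatrix_apply]
    rfl
  simp only [htr]
  let T : E →ₗ[ℂ] E := ∑ i, (heckeFunctional π μ f (η i) (hint i)).smulRight (b i : E)
  have hT : ∀ v, T v = ∑ i, (∫ x, f x * η i (π x v) ∂μ) • (b i : E) := by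
    intro v
    simp only [T, LinearMap.sum_apply, LinearMap.smulRight_apply]
    rfl
  have hTW : ∀ v, T v ∈ fixedVectors π K := by
    intro v
    rw [hT]
    exact Submodule.sum_mem _ fun i _ => Submodule.smul_mem _ _ (b i).2
  have hTH : IsHeckeOperator π μ f T := by
    intro v ξ hξ
    rw [← integral_average hX hπ hKo hf hconv hξ, hT, map_sum]
    have h1 : ∀ w, ξ (average π K w) = ∑ i, η i w * ξ (b i) := by
      intro w
      have h2 := congrArg (fun y : fixedVectors π K => ξ y) (b.sum_repr (averageOnto π K w))
      simp only [coe_averageOnto hfo] at h2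
      rw [← h2, Submodule.coe_sum, map_sum]
      refine Finset.sum_congr rfl fun i _ => ?_
      rw [Submodule.coe_smul, map_smul, smul_eq_mul]
      rfl
    simp only [h1, Finset.mul_sum, ← mul_assoc]
    rw [integral_finsetSum _ fun i _ => (hint i v).mul_const _]
    refine Finset.sum_congr rfl fun i _ => ?_
    rw [map_smul, smul_eq_mul, integral_mul_const]
  refine ⟨integrable_finsetSum _ fun i _ => hint i _, T, fun T' => ⟨fun h => ?_, ?_⟩, ?_⟩
  · ext v
    exact hπ.eq_of_forall_smooth hX hreg fun ξ hξ => (h v ξ hξ).trans (hTH v ξ hξ).symm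
  · rintro rfl
    exact hTH
  · obtain ⟨h1, h2⟩ := finiteRankTrace_eq hTW
    refine ⟨h1, ?_⟩
    rw [h2, LinearMap.trace_eq_matrix_trace ℂ b, Matrix.trace,
      integral_finsetSum _ fun i _ => hint i _]
    refine Finset.sum_congr rfl fun i _ => ?_
    rw [Matrix.diag_apply, LinearMap.toMatrix_apply]
    have h3 : T.restrict (p := fixedVectors π K) (q := fixedVectors π K) (fun x _ => hTW x) (b i) =
        ∑ j, (∫ x, f x * η j (π x (b i : E)) ∂μ) • b j := by
      apply Subtype.ext
      rw [Submodule.coe_sum]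
      exact hT _
    rw [h3, b.repr_sum_self]

variable {l : Line X} {σ : (levi l ⧸ (compactLevi l).subgroupOf (levi l)) →* levi l}

/-- On the support of a Hecke function that vanishes outside the hyperbolic set, the local trace
is the character. -/
theorem IsHyperbolicCharacter.eq_trace_localOperator (hX : X.IsTree)
    (hreg : X.IsRegularOfDegree (q + 1)) (hσ : IsSplitting l σ) (hπ : IsAdmissible π)
    {θ : Aut X → ℂ} (hθ : IsHyperbolicCharacter π l σ θ) {o : V} {R : ℕ} {x : Aut X}
    (hx : ∀ k ∈ fixator X {u | X.dist o u ≤ R}, x * k ∈ hyperbolicSet X) :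
    θ x = LinearMap.trace ℂ _ (localOperator π (fixator X {u | X.dist o u ≤ R}) x) := by
  have hx1 : x ∈ hyperbolicSet X := by simpa using hx 1 (one_mem _)
  obtain ⟨m, n, hn, hm⟩ := exists_axis hX hx1
  have hR := dist_proj_lt_of_hyperbolic hX hreg m hm o R fun k hk => hx k hk
  obtain ⟨a, ha, haj, h, hh, rfl⟩ := exists_conj_mem_negTorus hX hreg hσ hn m hm
  rw [hθ.conj _ (mem_hyperbolicSet_of_translation hX l hn haj), hθ.trace_eq a ha]
  have hR' : l.depth (h⁻¹ o) < R := by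
    have := (l.proj_map hX m (Equiv.refl ℤ) (fun _ _ => rfl) hh (h⁻¹ o)).2
    rw [RelIso.apply_inv_self] at this
    rwa [← this]
  -- The conjugator `h` carries `l` to the axis, so the ball about `h⁻¹ o` contains an edge of `l`.
  rw [← (trace_localOperator_ball hX hreg hπ hn haj hR').2]
  have hfo : ∀ o, HasFiniteOrbits (π.comp (fixator X {u | X.dist o u ≤ R}).subtype) := fun o =>
    hπ.hasFiniteOrbits hX o (fixator_anti (Set.singleton_subset_iff.2 (by simp)))
  have hfin : ∀ o, FiniteDimensional ℂ (fixedVectors π (fixator X {u | X.dist o u ≤ R})) :=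
    fun o => hπ.finiteDimensional_fixator hX hreg (finite_ball hX o R) ⟨o, by simp⟩
  have := hfin o
  have := hfin (h⁻¹ o)
  refine (trace_localOperator_conj (hfo o) (hfo (h⁻¹ o)) (fun k => ?_) _).symm
  simp only [mem_fixator, Set.mem_ofPred_eq]
  constructor
  · intro hk u hu
    rw [RelIso.mul_apply, RelIso.mul_apply, hk, RelIso.apply_inv_self]
    rwa [dist_map hX]
  · intro hk u hu
    have := hk (h u) (by rwa [← dist_map hX h⁻¹, RelIso.inv_apply_self])
    rw [RelIso.mul_apply, RelIso.mul_apply, RelIso.inv_apply_self] at this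
    exact h.injective this

end Hecke
end TreeCharacter

/-! ### The trace formula. -/

theorem mainTheorem7 {V E : Type*} [AddCommGroup E] [Module ℂ E]
    (X : SimpleGraph V) [X.LocallyFinite] (hX : X.IsTree)
    (q : ℕ) (hq : 1 ≤ q) (hreg : X.IsRegularOfDegree (q + 1))
    (l : TreeCharacter.Line X)
    (σ : (TreeCharacter.levi l ⧸
        (TreeCharacter.compactLevi l).subgroupOf (TreeCharacter.levi l)) →* TreeCharacter.levi l)
    (hσ : TreeCharacter.IsSplitting l σ)
    (μ : MeasureTheory.Measure (TreeCharacter.Aut X)) [μ.IsHaarMeasure]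
    (π : Representation ℂ (TreeCharacter.Aut X) E) (hπ : TreeCharacter.IsAdmissible π) :
    FiniteDimensional ℂ (TreeCharacter.jacquetSpace π l.infty) ∧
    (∃! θ : TreeCharacter.Aut X → ℂ, TreeCharacter.IsHyperbolicCharacter π l σ θ) ∧
    ∀ θ : TreeCharacter.Aut X → ℂ, TreeCharacter.IsHyperbolicCharacter π l σ θ →
      ∀ f : TreeCharacter.Aut X → ℂ, TreeCharacter.IsHeckeFunction μ f →
        Function.support f ⊆ TreeCharacter.hyperbolicSet X →
        (HasCompactSupport f → TreeCharacter.HeckeConverges π μ f) ∧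
        (TreeCharacter.HeckeConverges π μ f →
          MeasureTheory.Integrable (fun x => f x * θ x) μ ∧
          ∃ T : E →ₗ[ℂ] E, (∀ T', TreeCharacter.IsHeckeOperator π μ f T' ↔ T' = T) ∧
            FiniteDimensional ℂ (LinearMap.range T) ∧
            TreeCharacter.finiteRankTrace T = ∫ x, f x * θ x ∂μ) := by
  obtain ⟨a, ha, haj⟩ := TreeCharacter.exists_mem_negTorus (σ := σ) hX hreg hσ (n := 1) one_pos
  refine ⟨(TreeCharacter.trace_localOperator_ball hX hreg hπ one_pos haj (o := l.vert 0) (R := 1)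
    (by rw [l.depth_vert hX]; exact one_pos)).1,
    TreeCharacter.isHyperbolicCharacter_unique hX hreg hσ π, fun θ hθ f hf hsupp =>
    ⟨hπ.heckeConverges hf, fun hconv => ?_⟩⟩
  obtain ⟨K, hK, -, hKf⟩ := hf.biinvariant
  obtain ⟨F, hF, hFK⟩ := TreeCharacter.exists_fixator_le hK
  -- The group of bi-invariance is shrunk to the fixator of a ball, the shape that the local trace
  -- computation needs.
  obtain ⟨R, hR⟩ := (hF.image fun u => X.dist (l.vert 0) u).bddAbove
  have hle : TreeCharacter.fixator X {u | X.dist (l.vert 0) u ≤ R} ≤ K :=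
    (TreeCharacter.fixator_anti fun u hu => hR ⟨u, hu, rfl⟩).trans hFK
  have hleft : ∀ k ∈ TreeCharacter.fixator X {u | X.dist (l.vert 0) u ≤ R}, ∀ x,
      f (k * x) = f x := fun k hk x => by
    simpa using hKf k (hle hk) 1 K.one_mem x
  have hright : ∀ k ∈ TreeCharacter.fixator X {u | X.dist (l.vert 0) u ≤ R}, ∀ x,
      f (x * k) = f x := fun k hk x => by
    simpa using hKf 1 K.one_mem k (hle hk) x
  have heq : ∀ x, f x * θ x = f x * LinearMap.trace ℂ _ (TreeCharacter.localOperator π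
      (TreeCharacter.fixator X {u | X.dist (l.vert 0) u ≤ R}) x) := by
    intro x
    by_cases hx : f x = 0
    · rw [hx, zero_mul, zero_mul]
    · rw [hθ.eq_trace_localOperator hX hreg hσ hπ]
      -- Right invariance keeps `f` nonzero on the whole coset of `x`, so this coset consists of
      -- hyperbolic elements.
      intro k hk
      apply hsupp
      rwa [Function.mem_support, hright k hk]
  simp only [heq]
  exact TreeCharacter.exists_heckeOperator hX hreg hπ (TreeCharacter.finite_ball hX _ R)
    ⟨l.vert 0, by simp⟩ hleft hconv
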